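/- Let $W$ be one of the finite irreducible Coxeter groups $\alpha_n$, $\beta_n$ ($n\ge 2$), $\mathrm{Dih}_d$ ($d\ge 3$, $n=2$) or $H_3$ ($n=3$), acting on Euclidean space $\mathbb R^n$ as the group generated by the simple reflections $S=\{s_1,\dots,s_n\}$ (numbered along the Coxeter graph), where the mirrors $H_i$ of the $s_i$ are linearly independent and $W$ acts as in its standard geometric representation. Let $W^*$ be its subgroup of rotations and $Z(W)$ its centre. For $I\subset S$ let $C_I=\bigcap_{s_i\in I}H_i\cap\bigcap_{s_i\notin I}H_i^+$, where $H_i^+$ is the open positive half-space of $s_i$, and let $\overline J$ be the image of $J\subset S$ under $s_i\mapsto s_{n-i+1}$. Let $I,J\subset S$ be non-empty with $|I|=|J|=n-1$, and fix points $p\in C_I$ and $q\in C_J$, with $p=q$ if $I=J$. A seed strut of type $(W,I,J)$ is an unordered pair $\{a,b\}$ of distinct points with $a\in Wp$ and $b\in Wq$; seed struts are counted up to the action of $W$. For a subgroup $G\le W$, a seed strut $x$ generates the set of struts $Gx=\{\{r(a),r(b)\} : r\in G\}$, and an endpoint of $x$ is univalent (with respect to $G$) if it belongs to exactly one strut of $Gx$.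 **Theorem.** Let $G=W$; or let $G=W^*$ and assume that $n\ge 3$ or $I=J$. If either $Z(W)$ is non-trivial and $I=J$, or $Z(W)$ is trivial and $I=\overline J$, then there is, up to the action of $W$, exactly one seed strut of type $(W,I,J)$ with a univalent endpoint. In all other cases there is none. -/

import Mathlib

/-- The irreducible Coxeter groups under consideration, given by their Coxeter matrices:
`α_n` (linear graph without labels), `β_n` (linear graph with one extreme edge labelled `4`),
the dihedral groups `dih_d` with `d ≥ 3` (`CoxeterMatrix.I m` has label `m + 2`), and `H_3`. -/
inductive IsConsidered : {n : ℕ} → CoxeterMatrix (Fin n) → Prop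
  | alpha (n : ℕ) (hn : 1 ≤ n) : IsConsidered (CoxeterMatrix.A n)
  | beta (n : ℕ) (hn : 2 ≤ n) : IsConsidered (CoxeterMatrix.B n)
  | dih (d : ℕ) (hd : 3 ≤ d) : IsConsidered (CoxeterMatrix.I (d - 2))
  | icosahedral : IsConsidered CoxeterMatrix.H₃

/-- The symmetric bilinear form on `ℝ^n` with `B(α_i, α_j) = -cos (π / m(i, j))` for the standard
basis `α_1, …, α_n` (the simple roots). For a finite Coxeter group it is positive definite, i.e.
`(ℝ^n, B)` is a Euclidean space, written in the basis of unit simple roots. -/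
noncomputable def coxForm {n : ℕ} (M : CoxeterMatrix (Fin n)) :
    LinearMap.BilinForm ℝ (Fin n → ℝ) :=
  Matrix.toBilin' (Matrix.of fun i j => -Real.cos (Real.pi / (M i j : ℝ)))

/-- The simple root `α_i`. -/
def simpleRoot {n : ℕ} (i : Fin n) : Fin n → ℝ := Pi.single i 1

theorem coxForm_simpleRoot_self {n : ℕ} (M : CoxeterMatrix (Fin n)) (i : Fin n) :
    ((2 : ℝ) • coxForm M (simpleRoot i)) (simpleRoot i) = 2 := by
  simp [coxForm, simpleRoot]

/-- The simple reflection `s_i : v ↦ v - 2 B(α_i, v) α_i`. -/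
noncomputable def simpleRefl {n : ℕ} (M : CoxeterMatrix (Fin n)) (i : Fin n) :
    (Fin n → ℝ) ≃ₗ[ℝ] (Fin n → ℝ) :=
  Module.reflection (coxForm_simpleRoot_self M i)

/-- The Coxeter group `W`, as the group of isometries generated by the simple reflections. -/
noncomputable def reflGroup {n : ℕ} (M : CoxeterMatrix (Fin n)) :
    Subgroup ((Fin n → ℝ) ≃ₗ[ℝ] (Fin n → ℝ)) :=
  Subgroup.closure (Set.range (simpleRefl M))

/-- The rotation subgroup `W^*`: the elements of `W` of determinant `1`. -/
noncomputable def rotGroup {n : ℕ} (M : CoxeterMatrix (Fin n)) :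
    Subgroup ((Fin n → ℝ) ≃ₗ[ℝ] (Fin n → ℝ)) :=
  reflGroup M ⊓ (LinearEquiv.det : ((Fin n → ℝ) ≃ₗ[ℝ] (Fin n → ℝ)) →* ℝˣ).ker

/-- The facet `C_I`: the intersection of the mirrors `H_i`, `i ∈ I`, and of the open positive
half-spaces `H_i^+`, `i ∉ I`. A set `I` of simple reflections is given by their indices. -/
def facet {n : ℕ} (M : CoxeterMatrix (Fin n)) (I : Finset (Fin n)) : Set (Fin n → ℝ) :=
  {v | (∀ i ∈ I, coxForm M (simpleRoot i) v = 0) ∧ ∀ i ∉ I, 0 < coxForm M (simpleRoot i) v}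

/-- `x` is a strut: an unordered pair of distinct endpoints, one in the `W`-orbit of `p` and one
in the `W`-orbit of `q`. -/
def IsStrut {n : ℕ} (M : CoxeterMatrix (Fin n)) (p q : Fin n → ℝ) (x : Sym2 (Fin n → ℝ)) : Prop :=
  ∃ u ∈ reflGroup M, ∃ w ∈ reflGroup M, u p ≠ w q ∧ x = s(u p, w q)

/-- The set of images of the strut `x` under the group `G`. For `G = W^*` this is the
polypolyhedron generated by the seed strut `x`; for `G = W` it is the orbit of `x`, i.e. the
class of all seed struts equivalent to `x`. -/
def generated {V : Type*} [AddCommGroup V] [Module ℝ V] (G : Subgroup (V ≃ₗ[ℝ] V)) (x : Sym2 V) :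
    Set (Sym2 V) :=
  {y | ∃ r ∈ G, y = x.map r}

/-- Some endpoint of `x` is incident to exactly one strut of the set `generated G x`. -/
def HasUnivalentEndpoint {V : Type*} [AddCommGroup V] [Module ℝ V] (G : Subgroup (V ≃ₗ[ℝ] V))
    (x : Sym2 V) : Prop :=
  ∃ a ∈ x, {y ∈ generated G x | a ∈ y}.encard = 1

/-- The number of seed struts with endpoints in the orbits of `p` and `q`, counted up to
equivalence under `W`, that have a univalent endpoint in the set of struts generated by `G`. -/
noncomputable def numUnivalent {n : ℕ} (M : CoxeterMatrix (Fin n))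
    (G : Subgroup ((Fin n → ℝ) ≃ₗ[ℝ] (Fin n → ℝ))) (p q : Fin n → ℝ) : ℕ∞ :=
  {O : Set (Sym2 (Fin n → ℝ)) | ∃ x, IsStrut M p q x ∧ HasUnivalentEndpoint G x ∧
    O = generated (reflGroup M) x}.encard

/-- The dual `J̄` of a set of simple reflections: its image under `s_i ↦ s_{n-i+1}`. -/
def dualSet {n : ℕ} (J : Finset (Fin n)) : Finset (Fin n) := J.image Fin.rev

/-! The stabilizer of a univalent endpoint must fix the other endpoint. Since `p` lies on `n - 1`
independent mirrors, the vectors fixed by its stabilizer in `W` form the line `ℝp`. For `n ≥ 3` the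
rotations `s_i s_j` with `i ≠ j` in `I` already cut out this line. For `n = 2` and `I = J` a
rotation `g` joins the endpoints; univalence forces `g p = g⁻¹ p`, and `g + g⁻¹` is scalar, so `g p`
again lies on `ℝp`. Hence the endpoints are collinear with the origin. Two points of the orbits on
the same ray would coincide, because the closed chamber meets each orbit at most once; so the
endpoints lie on opposite rays (`exists_neg_of_univalent`). Conversely, every strut through the
origin is univalent (`hasUnivalentEndpoint_of_neg`), and all of these are `W`-equivalent
(`numUnivalent_eq_one`). The count is therefore 1 or 0 according to whether `Wq` meets the ray
opposite to `p`.

Some element of `W` maps the chamber to its negative. It acts either as `-1`, and then the condition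
is `I = J` and the centre is non-trivial, or as minus the reversal of the simple roots, and then the
condition is `I = dualSet J` and the centre is trivial. The first case is that of `β_n`, `H_3` and
even `d`, the second that of `α_n` (`n ≥ 2`) and odd `d`.

The chamber property (`eq_of_dominant`) comes from sign coherence of the roots by way of the
exchange condition; sign coherence is read off from an explicit root system for each type. -/

section Basic

/-! ### Reflections, the exchange condition and the fundamental chamber. -/

variable {n : ℕ} {M : CoxeterMatrix (Fin n)}

theorem simpleRefl_apply (M : CoxeterMatrix (Fin n)) (i : Fin n) (v : Fin n → ℝ) :
    simpleRefl M i v = v - (2 * coxForm M (simpleRoot i) v) • simpleRoot i := by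
  simp [simpleRefl, Module.reflection_apply, smul_eq_mul]

theorem coxForm_simpleRoot_left (M : CoxeterMatrix (Fin n)) (i : Fin n) (v : Fin n → ℝ) :
    coxForm M (simpleRoot i) v = ∑ j, -Real.cos (Real.pi / (M i j : ℝ)) * v j := by
  simp [coxForm, simpleRoot, Matrix.toBilin'_apply, Pi.single_apply]

theorem coxForm_simpleRoot_simpleRoot (M : CoxeterMatrix (Fin n)) (i j : Fin n) :
    coxForm M (simpleRoot i) (simpleRoot j) = -Real.cos (Real.pi / (M i j : ℝ)) := by
  simp [coxForm, simpleRoot]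

theorem coxForm_apply (M : CoxeterMatrix (Fin n)) (v w : Fin n → ℝ) :
    coxForm M v w = ∑ i, ∑ j, v i * (-Real.cos (Real.pi / (M i j : ℝ))) * w j := by
  simp [coxForm, Matrix.toBilin'_apply]

theorem coxForm_comm (M : CoxeterMatrix (Fin n)) (v w : Fin n → ℝ) :
    coxForm M v w = coxForm M w v := by
  rw [coxForm_apply, coxForm_apply, Finset.sum_comm]
  refine Finset.sum_congr rfl fun i _ => Finset.sum_congr rfl fun j _ => ?_
  rw [M.symmetric j i]
  ring

theorem coxForm_simpleRoot_same (M : CoxeterMatrix (Fin n)) (i : Fin n) :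
    coxForm M (simpleRoot i) (simpleRoot i) = 1 := by
  simp [coxForm_simpleRoot_simpleRoot]

theorem coxForm_simpleRefl (M : CoxeterMatrix (Fin n)) (i : Fin n) (v w : Fin n → ℝ) :
    coxForm M (simpleRefl M i v) (simpleRefl M i w) = coxForm M v w := by
  simp only [simpleRefl_apply, map_sub, map_smul, LinearMap.sub_apply, LinearMap.smul_apply,
    smul_eq_mul, coxForm_simpleRoot_same, coxForm_comm M v (simpleRoot i)]
  ring

theorem simpleRefl_mul_self (M : CoxeterMatrix (Fin n)) (i : Fin n) :
    simpleRefl M i * simpleRefl M i = 1 := by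
  rw [mul_eq_one_iff_eq_inv]
  exact (Module.reflection_inv _).symm

theorem simpleRefl_mem (M : CoxeterMatrix (Fin n)) (i : Fin n) : simpleRefl M i ∈ reflGroup M :=
  Subgroup.subset_closure ⟨i, rfl⟩

theorem simpleRefl_simpleRoot (M : CoxeterMatrix (Fin n)) (i : Fin n) :
    simpleRefl M i (simpleRoot i) = -simpleRoot i := by
  rw [simpleRefl_apply, coxForm_simpleRoot_same]
  module

theorem coxForm_map {g : (Fin n → ℝ) ≃ₗ[ℝ] (Fin n → ℝ)} (hg : g ∈ reflGroup M)
    (v w : Fin n → ℝ) : coxForm M (g v) (g w) = coxForm M v w := by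
  induction hg using Subgroup.closure_induction generalizing v w with
  | mem x hx =>
    obtain ⟨i, rfl⟩ := hx
    exact coxForm_simpleRefl M i v w
  | one => rfl
  | mul x y _ _ hx hy => rw [LinearEquiv.mul_apply, LinearEquiv.mul_apply, hx, hy]
  | inv x _ hx =>
    rw [← hx, ← LinearEquiv.mul_apply, ← LinearEquiv.mul_apply, mul_inv_cancel]
    rfl

theorem det_simpleRefl (M : CoxeterMatrix (Fin n)) (i : Fin n) :
    LinearEquiv.det (simpleRefl M i) = -1 := by
  ext
  rw [LinearEquiv.coe_det]
  have h : (simpleRefl M i : (Fin n → ℝ) →ₗ[ℝ] (Fin n → ℝ)) =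
      LinearMap.transvection (((-2 : ℝ) • coxForm M (simpleRoot i))) (simpleRoot i) := by
    ext1 v
    ext1
    simp [simpleRefl_apply, LinearMap.transvection.apply]
    ring
  rw [h, LinearMap.transvection.det, LinearMap.smul_apply, coxForm_simpleRoot_same]
  norm_num

theorem det_of_mem {g : (Fin n → ℝ) ≃ₗ[ℝ] (Fin n → ℝ)} (hg : g ∈ reflGroup M) :
    LinearEquiv.det g = 1 ∨ LinearEquiv.det g = -1 := by
  induction hg using Subgroup.closure_induction with
  | mem x hx =>
    obtain ⟨i, rfl⟩ := hx
    exact Or.inr (det_simpleRefl M i)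
  | one => exact Or.inl (map_one _)
  | mul x y _ _ hx hy => rcases hx with h | h <;> rcases hy with h' | h' <;> simp [h, h']
  | inv x _ hx => rcases hx with h | h <;> simp [h]

/-- The product of the simple reflections along a word. -/
noncomputable def reflWord (M : CoxeterMatrix (Fin n)) (L : List (Fin n)) :
    (Fin n → ℝ) ≃ₗ[ℝ] (Fin n → ℝ) :=
  (L.map (simpleRefl M)).prod

@[simp] theorem reflWord_nil (M : CoxeterMatrix (Fin n)) : reflWord M [] = 1 := rfl

@[simp] theorem reflWord_cons (M : CoxeterMatrix (Fin n)) (i : Fin n) (L : List (Fin n)) :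
    reflWord M (i :: L) = simpleRefl M i * reflWord M L := by
  simp [reflWord]

theorem reflWord_append (M : CoxeterMatrix (Fin n)) (L L' : List (Fin n)) :
    reflWord M (L ++ L') = reflWord M L * reflWord M L' := by
  simp [reflWord]

theorem reflWord_mem (M : CoxeterMatrix (Fin n)) (L : List (Fin n)) :
    reflWord M L ∈ reflGroup M := by
  induction L with
  | nil => exact one_mem _
  | cons i L ih => rw [reflWord_cons]; exact mul_mem (simpleRefl_mem M i) ih

theorem reflWord_reverse (M : CoxeterMatrix (Fin n)) (L : List (Fin n)) :
    reflWord M L.reverse = (reflWord M L)⁻¹ := by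
  induction L with
  | nil => simp
  | cons i L ih =>
    rw [List.reverse_cons, reflWord_append, ih, reflWord_cons, reflWord_nil, mul_one, reflWord_cons,
      mul_inv_rev, inv_eq_of_mul_eq_one_left (simpleRefl_mul_self M i)]

theorem exists_reflWord {g : (Fin n → ℝ) ≃ₗ[ℝ] (Fin n → ℝ)} (hg : g ∈ reflGroup M) :
    ∃ L, g = reflWord M L := by
  induction hg using Subgroup.closure_induction with
  | mem x hx =>
    obtain ⟨i, rfl⟩ := hx
    exact ⟨[i], by simp⟩
  | one => exact ⟨[], rfl⟩
  | mul x y _ _ hx hy =>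
    obtain ⟨L, rfl⟩ := hx
    obtain ⟨L', rfl⟩ := hy
    exact ⟨L ++ L', (reflWord_append M L L').symm⟩
  | inv x _ hx =>
    obtain ⟨L, rfl⟩ := hx
    exact ⟨L.reverse, (reflWord_reverse M L).symm⟩

/-- Every root has either only non-negative or only non-positive coordinates with respect to the
simple roots. -/
def SignCoherent (M : CoxeterMatrix (Fin n)) : Prop :=
  ∀ g ∈ reflGroup M, ∀ i, 0 ≤ g (simpleRoot i) ∨ g (simpleRoot i) ≤ 0

/-- Sign coherence follows from the existence of a set of sign-coherent vectors which contains the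
simple roots and is stable under the simple reflections. -/
theorem signCoherent_of_invariant (Φ : Set (Fin n → ℝ)) (hsimple : ∀ i, simpleRoot i ∈ Φ)
    (hrefl : ∀ i, ∀ v ∈ Φ, simpleRefl M i v ∈ Φ) (hsign : ∀ v ∈ Φ, 0 ≤ v ∨ v ≤ 0) :
    SignCoherent M := by
  intro g hg i
  obtain ⟨L, rfl⟩ := exists_reflWord hg
  apply hsign
  clear hg
  induction L with
  | nil => exact hsimple i
  | cons j L ih => rw [reflWord_cons]; exact hrefl j _ ih

/-- `v` lies in the closed fundamental chamber. -/
def Dominant (M : CoxeterMatrix (Fin n)) (v : Fin n → ℝ) : Prop :=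
  ∀ i, 0 ≤ coxForm M (simpleRoot i) v

theorem mul_simpleRefl_of_map_simpleRoot {g : (Fin n → ℝ) ≃ₗ[ℝ] (Fin n → ℝ)}
    (hg : g ∈ reflGroup M) {i j : Fin n} (h : g (simpleRoot i) = simpleRoot j) :
    g * simpleRefl M i = simpleRefl M j * g := by
  ext1 v
  rw [LinearEquiv.mul_apply, LinearEquiv.mul_apply, simpleRefl_apply, simpleRefl_apply, map_sub,
    map_smul, h, ← coxForm_map hg (simpleRoot i) v, h]

/-- A simple reflection changes only the `j`-th coordinate, so a root whose sign it flips is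
supported on `j`; invariance of the form makes the coefficient 1. -/
theorem eq_simpleRoot_of_simpleRefl_nonpos {g : (Fin n → ℝ) ≃ₗ[ℝ] (Fin n → ℝ)}
    (hg : g ∈ reflGroup M) {i j : Fin n} (h₀ : 0 ≤ g (simpleRoot i))
    (h₁ : simpleRefl M j (g (simpleRoot i)) ≤ 0) : g (simpleRoot i) = simpleRoot j := by
  have hne : ∀ k, k ≠ j → g (simpleRoot i) k = 0 := by
    intro k hk
    refine le_antisymm ?_ (h₀ k)
    have := h₁ k
    rw [simpleRefl_apply] at this
    simpa [simpleRoot, hk] using this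
  have hsmul : g (simpleRoot i) = g (simpleRoot i) j • simpleRoot j := by
    ext k
    by_cases hk : k = j
    · subst hk; simp [simpleRoot]
    · rw [hne k hk]; simp [simpleRoot, hk]
  have hnorm : coxForm M (g (simpleRoot i)) (g (simpleRoot i)) = 1 := by
    rw [coxForm_map hg, coxForm_simpleRoot_same]
  rw [hsmul] at hnorm
  simp only [map_smul, LinearMap.smul_apply, coxForm_simpleRoot_same, smul_eq_mul, mul_one] at hnorm
  have h0 := h₀ j
  have : g (simpleRoot i) j = 1 := by
    have h0' : 0 ≤ g (simpleRoot i) j := h0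
    nlinarith
  rw [hsmul, this, one_smul]

/-- The exchange condition. -/
theorem exchange (hM : SignCoherent M) (i : Fin n) (L : List (Fin n))
    (h : reflWord M L (simpleRoot i) ≤ 0) :
    ∃ L' : List (Fin n), L'.length < L.length ∧ reflWord M L * simpleRefl M i = reflWord M L' := by
  induction L with
  | nil =>
    have := h i
    simp [simpleRoot] at this
    linarith
  | cons j L ih =>
    rcases hM _ (reflWord_mem M L) i with h₀ | h₀
    · refine ⟨L, by simp, ?_⟩
      rw [reflWord_cons] at h
      have := eq_simpleRoot_of_simpleRefl_nonpos (reflWord_mem M L) h₀ h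
      rw [reflWord_cons, mul_assoc, mul_simpleRefl_of_map_simpleRoot (reflWord_mem M L) this,
        ← mul_assoc, simpleRefl_mul_self, one_mul]
    · obtain ⟨L', hlt, hL'⟩ := ih h₀
      exact ⟨j :: L', by simpa using hlt, by rw [reflWord_cons, mul_assoc, hL', reflWord_cons]⟩

/-- Split off the last letter `i`. If the remaining word keeps `α_i` non-negative, then `s_i` only
subtracts a non-negative vector; otherwise exchange yields a shorter word. The order is
coordinatewise in the simple roots. -/
theorem reflWord_le_of_dominant (hM : SignCoherent M) {v : Fin n → ℝ} (hv : Dominant M v) :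
    ∀ (k : ℕ) (L : List (Fin n)), L.length = k → reflWord M L v ≤ v := by
  intro k
  induction k using Nat.strong_induction_on with
  | _ k ih =>
    intro L hL
    rcases List.eq_nil_or_concat L with rfl | ⟨L₀, i, rfl⟩
    · exact le_rfl
    · rw [List.concat_eq_append] at hL ⊢
      have hlen : L₀.length < k := by simp at hL; omega
      have hw : reflWord M (L₀ ++ [i]) = reflWord M L₀ * simpleRefl M i := by
        simp [reflWord_append]
      rcases hM _ (reflWord_mem M L₀) i with h₀ | h₀
      · have h1 := ih _ hlen L₀ rfl
        rw [hw, LinearEquiv.mul_apply, simpleRefl_apply, map_sub, map_smul]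
        have h2 : 0 ≤ (2 * coxForm M (simpleRoot i) v) • reflWord M L₀ (simpleRoot i) :=
          smul_nonneg (by have := hv i; positivity) h₀
        exact (sub_le_self _ h2).trans h1
      · obtain ⟨L', hlt, hL'⟩ := exchange hM i L₀ h₀
        rw [hw, hL']
        exact ih _ (hlt.trans hlen) L' rfl

/-- The closed fundamental chamber meets every orbit in at most one point. -/
theorem eq_of_dominant (hM : SignCoherent M) {g : (Fin n → ℝ) ≃ₗ[ℝ] (Fin n → ℝ)}
    (hg : g ∈ reflGroup M) {v : Fin n → ℝ} (hv : Dominant M v) (hgv : Dominant M (g v)) :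
    g v = v := by
  obtain ⟨L, hL⟩ := exists_reflWord hg
  obtain ⟨L', hL'⟩ := exists_reflWord (inv_mem hg)
  -- A dominant vector dominates its orbit; this applies to `v` with `g` and to `g v` with `g⁻¹`.
  apply le_antisymm
  · have := reflWord_le_of_dominant hM hv _ L rfl
    rwa [← hL] at this
  · have := reflWord_le_of_dominant hM hgv _ L' rfl
    rwa [← hL', ← LinearEquiv.mul_apply, inv_mul_cancel] at this

/-- The form `coxForm M` is non-degenerate. -/
def CoxNondegenerate (M : CoxeterMatrix (Fin n)) : Prop :=
  ∀ v, (∀ i, coxForm M (simpleRoot i) v = 0) → v = 0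

theorem exists_coxForm_eq (hM : CoxNondegenerate M) (f : Fin n → ℝ) :
    ∃ v, ∀ i, coxForm M (simpleRoot i) v = f i := by
  let T : (Fin n → ℝ) →ₗ[ℝ] (Fin n → ℝ) := LinearMap.pi fun i => coxForm M (simpleRoot i)
  have hinj : Function.Injective T := by
    rw [injective_iff_map_eq_zero]
    intro v hv
    exact hM v fun i => congrFun hv i
  obtain ⟨v, hv⟩ := LinearMap.injective_iff_surjective.1 hinj f
  exact ⟨v, fun i => congrFun hv i⟩

end Basic

/-! ### Facets of the chamber that are rays. -/

section Facet

variable {n : ℕ} {M : CoxeterMatrix (Fin n)} {I J : Finset (Fin n)} {p q : Fin n → ℝ}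

theorem dominant_of_mem_facet (hp : p ∈ facet M I) : Dominant M p := by
  intro i
  by_cases hi : i ∈ I
  · exact (hp.1 i hi).ge
  · exact (hp.2 i hi).le

theorem smul_mem_facet (hp : p ∈ facet M I) {t : ℝ} (ht : 0 < t) : t • p ∈ facet M I := by
  refine ⟨fun i hi => ?_, fun i hi => ?_⟩
  · rw [map_smul, hp.1 i hi, smul_zero]
  · rw [map_smul]
    exact mul_pos ht (hp.2 i hi)

theorem eq_of_mem_facet (hp : p ∈ facet M I) (hp' : p ∈ facet M J) : I = J := by
  ext i
  constructor
  · intro hi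
    by_contra hj
    exact (hp'.2 i hj).ne' (hp.1 i hi)
  · intro hj
    by_contra hi
    exact (hp.2 i hi).ne' (hp'.1 i hj)

theorem exists_forall_notMem_iff (hI : I.card + 1 = n) : ∃ k, ∀ i, i ∉ I ↔ i = k := by
  have : Iᶜ.card = 1 := by rw [Finset.card_compl, Fintype.card_fin]; omega
  obtain ⟨k, hk⟩ := Finset.card_eq_one.1 this
  exact ⟨k, fun i => by rw [← Finset.mem_compl, hk, Finset.mem_singleton]⟩

theorem ne_zero_of_mem_facet (hI : I.card + 1 = n) (hp : p ∈ facet M I) : p ≠ 0 := by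
  obtain ⟨k, hk⟩ := exists_forall_notMem_iff hI
  rintro rfl
  have := hp.2 k ((hk k).2 rfl)
  simp at this

/-- Only one simple root `k` lies outside `I`. Subtracting the multiple of `p` that matches the
pairing with `α_k` leaves a vector orthogonal to all simple roots. -/
theorem exists_smul_eq (hM : CoxNondegenerate M) (hI : I.card + 1 = n) (hp : p ∈ facet M I)
    {v : Fin n → ℝ} (hv : ∀ i ∈ I, coxForm M (simpleRoot i) v = 0) : ∃ t : ℝ, v = t • p := by
  obtain ⟨k, hk⟩ := exists_forall_notMem_iff hI
  have hpk := hp.2 k ((hk k).2 rfl)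
  refine ⟨coxForm M (simpleRoot k) v / coxForm M (simpleRoot k) p, ?_⟩
  rw [← sub_eq_zero]
  apply hM
  intro i
  by_cases hi : i ∈ I
  · simp [hv i hi, hp.1 i hi]
  · rw [hk] at hi
    subst hi
    rw [map_sub, map_smul, smul_eq_mul, div_mul_cancel₀ _ hpk.ne', sub_self]

theorem eq_smul_of_map_eq_smul (hM : SignCoherent M) {g : (Fin n → ℝ) ≃ₗ[ℝ] (Fin n → ℝ)}
    (hg : g ∈ reflGroup M) (hp : p ∈ facet M I) (hq : q ∈ facet M J) {t : ℝ} (ht : 0 < t)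
    (h : g q = t • p) : q = t • p := by
  rw [← h]
  refine (eq_of_dominant hM hg (dominant_of_mem_facet hq) ?_).symm
  rw [h]
  exact dominant_of_mem_facet (smul_mem_facet hp ht)

end Facet

/-! ### Univalent endpoints and struts through the origin. -/

section Univalent

variable {n : ℕ} {M : CoxeterMatrix (Fin n)} {I J : Finset (Fin n)} {p q : Fin n → ℝ}
  {G : Subgroup ((Fin n → ℝ) ≃ₗ[ℝ] (Fin n → ℝ))}

theorem map_eq_self_of_encard_eq_one {V : Type*} [AddCommGroup V] [Module ℝ V]
    {G : Subgroup (V ≃ₗ[ℝ] V)} {a : V} {x : Sym2 V} (ha : a ∈ x)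
    (h : {y ∈ generated G x | a ∈ y}.encard = 1) {r : V ≃ₗ[ℝ] V} (hr : r ∈ G)
    (har : a ∈ x.map r) : x.map r = x := by
  obtain ⟨y, hy⟩ := Set.encard_eq_one.1 h
  have h1 : x.map r ∈ {y ∈ generated G x | a ∈ y} := ⟨⟨r, hr, rfl⟩, har⟩
  have h2 : x ∈ {y ∈ generated G x | a ∈ y} :=
    ⟨⟨1, one_mem G, by rw [LinearEquiv.coe_one, Sym2.map_id]; rfl⟩, ha⟩
  rw [hy, Set.mem_singleton_iff] at h1 h2
  rw [h1, h2]

/-- A linear automorphism of determinant `1` in dimension two satisfies `g + g⁻¹ = tr g`. -/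
theorem map_add_inv_map_eq_smul (g : (Fin 2 → ℝ) ≃ₗ[ℝ] (Fin 2 → ℝ)) (hg : LinearEquiv.det g = 1)
    (v : Fin 2 → ℝ) : ∃ t : ℝ, g v + g⁻¹ v = t • v := by
  set A := LinearMap.toMatrix' (g : (Fin 2 → ℝ) →ₗ[ℝ] (Fin 2 → ℝ)) with hA
  have hmul : ∀ w, g w = A.mulVec w := fun w => by
    rw [hA, LinearMap.toMatrix'_mulVec]; rfl
  have hdet : A 0 0 * A 1 1 - A 0 1 * A 1 0 = 1 := by
    rw [← Matrix.det_fin_two, hA, LinearMap.det_toMatrix', ← LinearEquiv.coe_det, hg, Units.val_one]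
  refine ⟨A 0 0 + A 1 1, ?_⟩
  apply g.injective
  rw [map_add, ← LinearEquiv.mul_apply g g⁻¹, mul_inv_cancel, LinearEquiv.coe_one, id, map_smul,
    hmul, hmul]
  ext i
  fin_cases i <;> simp
  · linear_combination (-v 0) * hdet
  · linear_combination (-v 1) * hdet

theorem simpleRoot_apply_self (i : Fin n) : simpleRoot i i = 1 := by simp [simpleRoot]

theorem simpleRoot_apply_of_ne {i j : Fin n} (hij : i ≠ j) : simpleRoot j i = 0 := by
  simp [simpleRoot, hij]

theorem coxForm_eq_zero_of_simpleRefl_eq {i : Fin n} {v : Fin n → ℝ} (h : simpleRefl M i v = v) :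
    coxForm M (simpleRoot i) v = 0 := by
  have := congrFun h i
  rw [simpleRefl_apply, Pi.sub_apply, Pi.smul_apply, smul_eq_mul, simpleRoot_apply_self] at this
  linarith

/-- Here `s_j v = s_i v`, and these differ from `v` by multiples of the independent vectors `α_j`
and `α_i`; comparing `i`-th coordinates suffices. -/
theorem coxForm_eq_zero_of_simpleRefl_mul_eq {i j : Fin n} (hij : i ≠ j) {v : Fin n → ℝ}
    (h : (simpleRefl M i * simpleRefl M j) v = v) : coxForm M (simpleRoot i) v = 0 := by
  have h' : simpleRefl M j v = simpleRefl M i v := by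
    have := congrArg (simpleRefl M i) h
    rwa [← LinearEquiv.mul_apply, ← mul_assoc, simpleRefl_mul_self, one_mul] at this
  have := congrFun h' i
  rw [simpleRefl_apply, simpleRefl_apply, Pi.sub_apply, Pi.smul_apply, Pi.sub_apply, Pi.smul_apply,
    smul_eq_mul, smul_eq_mul, simpleRoot_apply_self, simpleRoot_apply_of_ne hij] at this
  linarith

theorem simpleRefl_apply_of_mem_facet (hp : p ∈ facet M I) {i : Fin n} (hi : i ∈ I) :
    simpleRefl M i p = p := by
  rw [simpleRefl_apply, hp.1 i hi]
  simp

/-- In dimension two, if `h p = h⁻¹ p` for a rotation `h`, then `h p` is a multiple of `p`. -/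
theorem exists_map_eq_smul_of_map_eq_inv_map (hn : n = 2)
    (h : (Fin n → ℝ) ≃ₗ[ℝ] (Fin n → ℝ)) (hdet : LinearEquiv.det h = 1)
    (hp : h p = h⁻¹ p) : ∃ t : ℝ, h p = t • p := by
  subst hn
  obtain ⟨t, ht⟩ := map_add_inv_map_eq_smul h hdet p
  rw [← hp] at ht
  refine ⟨t / 2, ?_⟩
  rw [div_eq_inv_mul, mul_smul, ← ht, ← two_smul ℝ (h p), smul_smul]
  norm_num

/-- If the endpoint `u p` of a strut is univalent, then the other endpoint lies on the line through
the origin and `u p`. -/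
theorem exists_eq_smul_of_univalent (hnd : CoxNondegenerate M)
    (hI : I.card + 1 = n) (hI₀ : I.Nonempty) (hp : p ∈ facet M I) (hpq : I = J → p = q)
    (hG : G = reflGroup M ∨ (G = rotGroup M ∧ (3 ≤ n ∨ I = J)))
    {u w : (Fin n → ℝ) ≃ₗ[ℝ] (Fin n → ℝ)} (hu : u ∈ reflGroup M) (hw : w ∈ reflGroup M)
    (hne : u p ≠ w q)
    (h : {y ∈ generated G s(u p, w q) | u p ∈ y}.encard = 1) : ∃ t : ℝ, w q = t • u p := by
  have hfix : ∀ r ∈ G, r (u p) = u p → r (w q) = w q := by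
    intro r hr hrp
    have := map_eq_self_of_encard_eq_one (Sym2.mem_mk_left _ _) h hr
      (by rw [Sym2.map_mk, hrp]; exact Sym2.mem_mk_left _ _)
    rw [Sym2.map_mk, hrp] at this
    exact Sym2.congr_right.1 this
  -- Conjugation by `u` moves the univalent endpoint to `p`, whose stabilizer contains the simple
  -- reflections of `I`.
  have hconj : ∀ x, u * x * u⁻¹ ∈ G → x p = p → x (u⁻¹ (w q)) = u⁻¹ (w q) := by
    intro x hx hxp
    have h1 := hfix _ hx (by
      rw [← LinearEquiv.mul_apply, inv_mul_cancel_right, LinearEquiv.mul_apply, hxp])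
    calc x (u⁻¹ (w q)) = (u⁻¹ * (u * x * u⁻¹)) (w q) := by
          rw [show u⁻¹ * (u * x * u⁻¹) = x * u⁻¹ by group]
          rfl
      _ = u⁻¹ (w q) := by rw [LinearEquiv.mul_apply, h1]
  suffices H : ∃ t : ℝ, u⁻¹ (w q) = t • p by
    obtain ⟨t, ht⟩ := H
    refine ⟨t, ?_⟩
    rw [← map_smul, ← ht, ← LinearEquiv.mul_apply, mul_inv_cancel]
    rfl
  have hdetconj : ∀ x, x ∈ reflGroup M → LinearEquiv.det x = 1 → u * x * u⁻¹ ∈ rotGroup M := by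
    intro x hx hdet
    refine Subgroup.mem_inf.2 ⟨mul_mem (mul_mem hu hx) (inv_mem hu), ?_⟩
    rw [MonoidHom.mem_ker]
    simp [hdet]
  rcases hG with rfl | ⟨rfl, hG⟩
  · refine exists_smul_eq hnd hI hp fun i hi => coxForm_eq_zero_of_simpleRefl_eq (hconj _ ?_ ?_)
    · exact mul_mem (mul_mem hu (simpleRefl_mem M i)) (inv_mem hu)
    · exact simpleRefl_apply_of_mem_facet hp hi
  · by_cases hn : 3 ≤ n
    · refine exists_smul_eq hnd hI hp fun i hi => ?_
      -- Since `n ≥ 3`, there is a second mirror through `p`, and `s_i s_j` is a rotation fixing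
      -- `p`.
      obtain ⟨j, hj, hji⟩ := Finset.exists_mem_ne (show 1 < I.card by omega) i
      refine coxForm_eq_zero_of_simpleRefl_mul_eq hji.symm (hconj _ (hdetconj _ ?_ ?_) ?_)
      · exact mul_mem (simpleRefl_mem M i) (simpleRefl_mem M j)
      · rw [map_mul, det_simpleRefl, det_simpleRefl]; norm_num
      · rw [LinearEquiv.mul_apply, simpleRefl_apply_of_mem_facet hp hj,
          simpleRefl_apply_of_mem_facet hp hi]
    · have hIJ : I = J := hG.resolve_left hn
      obtain ⟨i, hi⟩ := hI₀
      have hn2 : n = 2 := by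
        have := Finset.card_pos.2 ⟨i, hi⟩
        omega
      rw [← hpq hIJ] at hne h ⊢
      -- The determinant is corrected, if necessary, by the reflection `s_i` that fixes `p`.
      obtain ⟨g, hg, hdet, hgp⟩ : ∃ g ∈ reflGroup M, LinearEquiv.det g = 1 ∧
          u⁻¹ (w p) = g p := by
        have hx : u⁻¹ * w ∈ reflGroup M := mul_mem (inv_mem hu) hw
        rcases det_of_mem hx with hd | hd
        · exact ⟨_, hx, hd, rfl⟩
        · refine ⟨u⁻¹ * w * simpleRefl M i, mul_mem hx (simpleRefl_mem M i), ?_, ?_⟩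
          · rw [map_mul, hd, det_simpleRefl]; norm_num
          · rw [LinearEquiv.mul_apply _ (simpleRefl M i), simpleRefl_apply_of_mem_facet hp hi]
            rfl
      have hwp : w p = u (g p) := by
        rw [← hgp, ← LinearEquiv.mul_apply, mul_inv_cancel]; rfl
      -- This rotation carries the far endpoint to the univalent one, so it preserves the strut and
      -- must swap its endpoints; hence `g⁻¹ p = g p`.
      have hrw : (u * g⁻¹ * u⁻¹) (w p) = u p := by
        rw [hwp, ← LinearEquiv.mul_apply, ← LinearEquiv.mul_apply]; group
      have hrG := hdetconj g⁻¹ (inv_mem hg) (by rw [map_inv, hdet, inv_one])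
      have hmap := map_eq_self_of_encard_eq_one (Sym2.mem_mk_left _ _) h hrG
        (by rw [Sym2.map_mk, hrw]; exact Sym2.mem_mk_right _ _)
      rw [Sym2.map_mk, hrw, Sym2.eq_iff] at hmap
      have hr : (u * g⁻¹ * u⁻¹) (u p) = w p := by
        rcases hmap with ⟨_, h2⟩ | ⟨h1, _⟩
        · exact absurd h2 hne
        · exact h1
      rw [← LinearEquiv.mul_apply, inv_mul_cancel_right, LinearEquiv.mul_apply, hwp] at hr
      rw [hgp]
      exact exists_map_eq_smul_of_map_eq_inv_map hn2 g hdet (u.injective hr).symm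

/-- The factor is non-zero because `q ≠ 0`. A positive factor would put `t • p` and `q` in the
chamber and in one orbit, giving `I = J`, then `p = q`, and the two endpoints would coincide. -/
theorem exists_neg_of_univalent (hsc : SignCoherent M) (hnd : CoxNondegenerate M)
    (hI : I.card + 1 = n) (hJ : J.card + 1 = n) (hI₀ : I.Nonempty)
    (hp : p ∈ facet M I) (hq : q ∈ facet M J) (hpq : I = J → p = q)
    (hG : G = reflGroup M ∨ (G = rotGroup M ∧ (3 ≤ n ∨ I = J)))
    {u w : (Fin n → ℝ) ≃ₗ[ℝ] (Fin n → ℝ)} (hu : u ∈ reflGroup M) (hw : w ∈ reflGroup M)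
    (hne : u p ≠ w q)
    (h : {y ∈ generated G s(u p, w q) | u p ∈ y}.encard = 1) :
    ∃ t : ℝ, t < 0 ∧ w q = t • u p := by
  obtain ⟨t, ht⟩ := exists_eq_smul_of_univalent hnd hI hI₀ hp hpq hG hu hw hne h
  refine ⟨t, ?_, ht⟩
  rcases lt_trichotomy t 0 with h0 | rfl | h0
  · exact h0
  · rw [zero_smul, LinearEquiv.map_eq_zero_iff] at ht
    exact absurd ht (ne_zero_of_mem_facet hJ hq)
  · have hq' : q = t • p := by
      refine eq_smul_of_map_eq_smul hsc (mul_mem (inv_mem hu) hw) hp hq h0 ?_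
      rw [LinearEquiv.mul_apply, ht, map_smul, ← LinearEquiv.mul_apply, inv_mul_cancel]
      rfl
    have hIJ : I = J := eq_of_mem_facet (hq' ▸ smul_mem_facet hp h0) hq
    rw [← map_smul, ← hq', ← hpq hIJ] at ht
    rw [← hpq hIJ] at hne
    exact absurd ht.symm hne

theorem hasUnivalentEndpoint_of_neg (hsc : SignCoherent M) (hI : I.card + 1 = n)
    (hp : p ∈ facet M I) (hG : G ≤ reflGroup M)
    {u : (Fin n → ℝ) ≃ₗ[ℝ] (Fin n → ℝ)} (hu : u ∈ reflGroup M) {t : ℝ} (ht : t < 0) :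
    HasUnivalentEndpoint G s(u p, t • u p) := by
  refine ⟨u p, Sym2.mem_mk_left _ _, Set.encard_eq_one.2 ⟨s(u p, t • u p), ?_⟩⟩
  ext y
  rw [Set.mem_singleton_iff]
  constructor
  · rintro ⟨⟨r, hr, rfl⟩, hy⟩
    rw [Sym2.map_mk, Sym2.mem_iff, map_smul] at hy
    rcases hy with hy | hy
    · rw [Sym2.map_mk, map_smul, ← hy]
    · have hr1 : r (u p) = t⁻¹ • u p := by
        nth_rw 2 [hy]
        rw [smul_smul, inv_mul_cancel₀ ht.ne, one_smul]
      -- If `r` carries the far endpoint to the near one, its square rescales `u p` by a positive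
      -- factor. An orbit meets the ray of `p` only once, so the factor is 1, `t = t⁻¹`, and `r`
      -- merely swaps the endpoints.
      have hr2 : (u⁻¹ * (r * r) * u) p = (t⁻¹ * t⁻¹) • p := by
        simp only [LinearEquiv.mul_apply]
        rw [hr1, map_smul, hr1, map_smul, map_smul, ← LinearEquiv.mul_apply, inv_mul_cancel,
          mul_smul]
        rfl
      have hpos : 0 < t⁻¹ * t⁻¹ := mul_pos_of_neg_of_neg (inv_lt_zero.2 ht) (inv_lt_zero.2 ht)
      have hpp : p = (t⁻¹ * t⁻¹) • p := eq_smul_of_map_eq_smul hsc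
        (mul_mem (mul_mem (inv_mem hu) (mul_mem (hG hr) (hG hr))) hu) hp hp hpos hr2
      have h1 : t⁻¹ * t⁻¹ = 1 := by
        have h3 : (t⁻¹ * t⁻¹) • p = (1 : ℝ) • p := by rw [one_smul, ← hpp]
        exact smul_left_injective ℝ (ne_zero_of_mem_facet hI hp) h3
      have ht1 : t = t⁻¹ := eq_inv_of_mul_eq_one_left (by
        rw [← mul_inv, inv_eq_one] at h1; exact h1)
      rw [Sym2.map_mk, map_smul, ← hy, hr1, ← ht1, Sym2.eq_swap]
  · rintro rfl
    exact ⟨⟨1, one_mem G, by rw [LinearEquiv.coe_one, Sym2.map_id]; rfl⟩, Sym2.mem_mk_left _ _⟩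

theorem exists_neg_of_isStrut (hsc : SignCoherent M) (hnd : CoxNondegenerate M)
    (hI : I.card + 1 = n) (hJ : J.card + 1 = n) (hI₀ : I.Nonempty) (hJ₀ : J.Nonempty)
    (hp : p ∈ facet M I) (hq : q ∈ facet M J) (hpq : I = J → p = q)
    (hG : G = reflGroup M ∨ (G = rotGroup M ∧ (3 ≤ n ∨ I = J)))
    {u w : (Fin n → ℝ) ≃ₗ[ℝ] (Fin n → ℝ)} (hu : u ∈ reflGroup M) (hw : w ∈ reflGroup M)
    (hne : u p ≠ w q) (h : HasUnivalentEndpoint G s(u p, w q)) :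
    ∃ t : ℝ, t < 0 ∧ w q = t • u p := by
  obtain ⟨a, ha, h⟩ := h
  rcases Sym2.mem_iff.1 ha with rfl | rfl
  · exact exists_neg_of_univalent hsc hnd hI hJ hI₀ hp hq hpq hG hu hw hne h
  · rw [Sym2.eq_swap] at h
    obtain ⟨t, ht, htp⟩ := exists_neg_of_univalent hsc hnd hJ hI hJ₀ hq hp
      (fun h => (hpq h.symm).symm) (hG.imp id (And.imp id (Or.imp id Eq.symm))) hw hu hne.symm h
    refine ⟨t⁻¹, inv_lt_zero.2 ht, ?_⟩
    rw [htp, smul_smul, inv_mul_cancel₀ ht.ne, one_smul]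

theorem generated_map_eq {V : Type*} [AddCommGroup V] [Module ℝ V]
    {G : Subgroup (V ≃ₗ[ℝ] V)} {u : V ≃ₗ[ℝ] V} (hu : u ∈ G) (x : Sym2 V) :
    generated G (x.map u) = generated G x := by
  ext y
  constructor
  · rintro ⟨r, hr, rfl⟩
    exact ⟨r * u, mul_mem hr hu, by rw [Sym2.map_map]; rfl⟩
  · rintro ⟨r, hr, rfl⟩
    refine ⟨r * u⁻¹, mul_mem hr (inv_mem hu), ?_⟩
    rw [Sym2.map_map]
    congr 1
    ext1 v
    rw [Function.comp_apply, ← LinearEquiv.mul_apply, inv_mul_cancel_right]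

theorem numUnivalent_eq_zero (hsc : SignCoherent M) (hnd : CoxNondegenerate M)
    (hI : I.card + 1 = n) (hJ : J.card + 1 = n) (hI₀ : I.Nonempty) (hJ₀ : J.Nonempty)
    (hp : p ∈ facet M I) (hq : q ∈ facet M J) (hpq : I = J → p = q)
    (hG : G = reflGroup M ∨ (G = rotGroup M ∧ (3 ≤ n ∨ I = J)))
    (h : ¬ ∃ g ∈ reflGroup M, ∃ t : ℝ, t < 0 ∧ g q = t • p) : numUnivalent M G p q = 0 := by
  rw [numUnivalent, Set.encard_eq_zero, Set.eq_empty_iff_forall_notMem]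
  rintro _ ⟨_, ⟨u, hu, w, hw, hne, rfl⟩, hx, rfl⟩
  obtain ⟨t, ht, htp⟩ := exists_neg_of_isStrut hsc hnd hI hJ hI₀ hJ₀ hp hq hpq hG hu hw hne hx
  refine h ⟨u⁻¹ * w, mul_mem (inv_mem hu) hw, t, ht, ?_⟩
  rw [LinearEquiv.mul_apply, htp, map_smul, ← LinearEquiv.mul_apply, inv_mul_cancel]
  rfl

theorem numUnivalent_eq_one (hsc : SignCoherent M) (hnd : CoxNondegenerate M)
    (hI : I.card + 1 = n) (hJ : J.card + 1 = n) (hI₀ : I.Nonempty) (hJ₀ : J.Nonempty)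
    (hp : p ∈ facet M I) (hq : q ∈ facet M J) (hpq : I = J → p = q)
    (hG : G = reflGroup M ∨ (G = rotGroup M ∧ (3 ≤ n ∨ I = J)))
    (h : ∃ g ∈ reflGroup M, ∃ t : ℝ, t < 0 ∧ g q = t • p) : numUnivalent M G p q = 1 := by
  obtain ⟨g, hg, t, ht, hgq⟩ := h
  have hp0 := ne_zero_of_mem_facet hI hp
  rw [numUnivalent, Set.encard_eq_one]
  refine ⟨generated (reflGroup M) s(p, g q), ?_⟩
  ext O
  rw [Set.mem_singleton_iff]
  constructor
  · rintro ⟨_, ⟨u, hu, w, hw, hne, rfl⟩, hx, rfl⟩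
    obtain ⟨t', ht', htp⟩ := exists_neg_of_isStrut hsc hnd hI hJ hI₀ hJ₀ hp hq hpq hG hu hw hne hx
    -- Two opposite struts have ratios `t` and `t'` of the same sign, so their quotient rescales `q`
    -- within its orbit and must be 1. Equal ratios make the struts equivalent.
    have hq' : q = (t' * t⁻¹) • q := by
      refine eq_smul_of_map_eq_smul hsc (mul_mem (inv_mem (mul_mem hu hg)) hw) hq hq
        (mul_pos_of_neg_of_neg ht' (inv_lt_zero.2 ht)) ?_
      have hug : (u * g) ((t' * t⁻¹) • q) = w q := by
        rw [map_smul, LinearEquiv.mul_apply, hgq, map_smul, smul_smul, mul_assoc,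
          inv_mul_cancel₀ ht.ne, mul_one, htp]
      rw [LinearEquiv.mul_apply, ← hug, ← LinearEquiv.mul_apply, inv_mul_cancel]
      rfl
    have h1 : t' * t⁻¹ = 1 := by
      have h3 : (t' * t⁻¹) • q = (1 : ℝ) • q := by rw [one_smul, ← hq']
      exact smul_left_injective ℝ (ne_zero_of_mem_facet hJ hq) h3
    have htt : t' = t := by
      rw [← div_eq_mul_inv] at h1
      exact (div_eq_one_iff_eq ht.ne).1 h1
    rw [← generated_map_eq hu s(p, g q), Sym2.map_mk, hgq, htp, htt, map_smul]
  · rintro rfl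
    refine ⟨s(p, g q), ⟨1, one_mem _, g, hg, ?_, rfl⟩, ?_, rfl⟩
    · rw [hgq]
      intro h
      have h3 : t • p = (1 : ℝ) • p := by rw [one_smul]; exact h.symm
      have : t = 1 := smul_left_injective ℝ hp0 h3
      linarith
    · rw [hgq]
      refine hasUnivalentEndpoint_of_neg (u := 1) hsc hI hp ?_ (one_mem _) ht
      rcases hG with rfl | ⟨rfl, _⟩
      · exact le_rfl
      · exact inf_le_left

end Univalent

/-! ### When the orbit of `q` meets the ray opposite to `p`, and the centre. -/

section Criterion

variable {n : ℕ} {M : CoxeterMatrix (Fin n)} {I J : Finset (Fin n)} {p q : Fin n → ℝ}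

theorem exists_neg_iff_of_neg_mem (hsc : SignCoherent M) (hp : p ∈ facet M I)
    (hq : q ∈ facet M J) (hpq : I = J → p = q) (h : ∃ g ∈ reflGroup M, ∀ v, g v = -v) :
    (∃ g ∈ reflGroup M, ∃ t : ℝ, t < 0 ∧ g q = t • p) ↔ I = J := by
  obtain ⟨g₀, hg₀, hg₀v⟩ := h
  constructor
  · rintro ⟨g, hg, t, ht, hgq⟩
    have hq' : q = (-t) • p := by
      refine eq_smul_of_map_eq_smul hsc (mul_mem hg₀ hg) hp hq (neg_pos.2 ht) ?_
      rw [LinearEquiv.mul_apply, hgq, hg₀v, neg_smul]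
    exact eq_of_mem_facet (hq' ▸ smul_mem_facet hp (neg_pos.2 ht)) hq
  · intro hIJ
    refine ⟨g₀, hg₀, -1, by norm_num, ?_⟩
    rw [← hpq hIJ, hg₀v, neg_one_smul]

theorem center_ne_bot_of_neg_mem (hn : n ≠ 0) (h : ∃ g ∈ reflGroup M, ∀ v, g v = -v) :
    Subgroup.center (reflGroup M) ≠ ⊥ := by
  obtain ⟨g₀, hg₀, hg₀v⟩ := h
  intro hbot
  have hmem : (⟨g₀, hg₀⟩ : reflGroup M) ∈ Subgroup.center (reflGroup M) := by
    rw [Subgroup.mem_center_iff]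
    intro g
    ext1
    ext1 v
    simp only [Subgroup.coe_mul, LinearEquiv.mul_apply, hg₀v, map_neg]
  rw [hbot, Subgroup.mem_bot] at hmem
  have h1 : g₀ = 1 := congrArg Subtype.val hmem
  have := congrFun (hg₀v (fun _ => 1)) ⟨0, Nat.pos_of_ne_zero hn⟩
  rw [h1] at this
  norm_num at this

/-- Compatibility of a Coxeter matrix with the reversal of its index set. -/
theorem coxForm_simpleRoot_rev (hrev : ∀ i j : Fin n, M i.rev j.rev = M i j) (i : Fin n)
    (v : Fin n → ℝ) :
    coxForm M (simpleRoot i) (fun j => v j.rev) = coxForm M (simpleRoot i.rev) v := by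
  rw [coxForm_simpleRoot_left, coxForm_simpleRoot_left, ← Equiv.sum_comp Fin.revPerm]
  refine Finset.sum_congr rfl fun j _ => ?_
  rw [Fin.revPerm_apply, Fin.rev_rev]
  nth_rw 1 [← hrev, Fin.rev_rev]

theorem mem_dualSet {J : Finset (Fin n)} {i : Fin n} : i ∈ dualSet J ↔ i.rev ∈ J := by
  rw [dualSet, Finset.mem_image]
  constructor
  · rintro ⟨j, hj, rfl⟩
    rwa [Fin.rev_rev]
  · intro h
    exact ⟨_, h, Fin.rev_rev i⟩

theorem rev_mem_facet (hrev : ∀ i j : Fin n, M i.rev j.rev = M i j) (hq : q ∈ facet M J) :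
    (fun j => q j.rev) ∈ facet M (dualSet J) := by
  refine ⟨fun i hi => ?_, fun i hi => ?_⟩
  · rw [coxForm_simpleRoot_rev hrev]
    exact hq.1 _ (mem_dualSet.1 hi)
  · rw [coxForm_simpleRoot_rev hrev]
    exact hq.2 _ fun h => hi (mem_dualSet.2 h)

/-- Up to sign, `g₀` sends `q` to its reversal, which lies in the facet of `dualSet J`; the question
becomes whether two facets of the chamber span the same ray. -/
theorem exists_neg_iff_of_neg_rev_mem (hsc : SignCoherent M) (hnd : CoxNondegenerate M)
    (hrev : ∀ i j : Fin n, M i.rev j.rev = M i j) (hI : I.card + 1 = n) (hp : p ∈ facet M I)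
    (hq : q ∈ facet M J) (h : ∃ g ∈ reflGroup M, ∀ v i, g v i = -v i.rev) :
    (∃ g ∈ reflGroup M, ∃ t : ℝ, t < 0 ∧ g q = t • p) ↔ I = dualSet J := by
  obtain ⟨g₀, hg₀, hg₀v⟩ := h
  have hq' := rev_mem_facet hrev hq
  have hg₀' : ∀ v, g₀ v = (-1 : ℝ) • fun j => v j.rev := fun v => by
    ext i
    rw [hg₀v]
    simp
  have hg₀'' : ∀ v, g₀ (fun j => v j.rev) = (-1 : ℝ) • v := fun v => by
    ext i
    rw [hg₀v]
    simp
  constructor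
  · rintro ⟨g, hg, t, ht, hgq⟩
    have hq'' : (fun j => q j.rev) = (-t) • p := by
      refine eq_smul_of_map_eq_smul hsc (mul_mem hg hg₀) hp hq' (neg_pos.2 ht) ?_
      rw [LinearEquiv.mul_apply, hg₀'', map_smul, hgq, smul_smul, neg_one_mul]
    exact eq_of_mem_facet (hq'' ▸ smul_mem_facet hp (neg_pos.2 ht)) hq'
  · intro hIJ
    subst hIJ
    obtain ⟨t, ht⟩ := exists_smul_eq hnd hI hp hq'.1
    have htpos : 0 < t := by
      obtain ⟨k, hk⟩ := exists_forall_notMem_iff hI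
      have hk' := (hk k).2 rfl
      have h1 := hq'.2 k hk'
      rw [ht, map_smul, smul_eq_mul] at h1
      exact pos_of_mul_pos_left h1 (hp.2 k hk').le
    refine ⟨g₀, hg₀, -t, neg_lt_zero.2 htpos, ?_⟩
    rw [hg₀', ht, smul_smul, neg_one_mul]

/-- Commuting with `s_i` preserves its `-1`-eigenline `ℝα_i`. Invariance of the form gives `c i * c
j = 1` for non-orthogonal neighbours, so the scalars, all `±1`, agree along the connected graph. -/
theorem exists_smul_of_mem_center
    (hchain : ∀ i j : Fin n, (i : ℕ) + 1 = j → coxForm M (simpleRoot i) (simpleRoot j) ≠ 0)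
    {g : (Fin n → ℝ) ≃ₗ[ℝ] (Fin n → ℝ)} (hg : g ∈ reflGroup M)
    (hcomm : ∀ i, g * simpleRefl M i = simpleRefl M i * g) :
    (∀ v, g v = v) ∨ ∀ v, g v = -v := by
  have hc : ∀ i, ∃ c : ℝ, g (simpleRoot i) = c • simpleRoot i := by
    intro i
    have h := LinearEquiv.congr_fun (hcomm i) (simpleRoot i)
    rw [LinearEquiv.mul_apply, LinearEquiv.mul_apply, simpleRefl_simpleRoot, map_neg,
      simpleRefl_apply] at h
    refine ⟨coxForm M (simpleRoot i) (g (simpleRoot i)), ?_⟩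
    have h2 : (2 : ℝ) • g (simpleRoot i) =
        (2 : ℝ) • coxForm M (simpleRoot i) (g (simpleRoot i)) • simpleRoot i := by
      rw [smul_smul, two_smul]
      nth_rw 1 [← neg_neg (g (simpleRoot i)), h]
      abel
    exact smul_right_injective _ two_ne_zero h2
  choose c hc using hc
  have hmul : ∀ i j, coxForm M (simpleRoot i) (simpleRoot j) ≠ 0 → c i * c j = 1 := by
    intro i j hij
    have h := coxForm_map hg (simpleRoot i) (simpleRoot j)
    rw [hc, hc, map_smul, map_smul, LinearMap.smul_apply, smul_smul, smul_eq_mul] at h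
    rw [mul_comm]
    exact mul_right_cancel₀ hij (by rw [h, one_mul])
  have hsq : ∀ i, c i * c i = 1 := fun i =>
    hmul i i (by rw [coxForm_simpleRoot_same]; exact one_ne_zero)
  have hconst : ∀ (k : ℕ) (hk : k < n), c ⟨k, hk⟩ = c ⟨0, by omega⟩ := by
    intro k
    induction k with
    | zero => intro _; rfl
    | succ k ih =>
      intro hk
      have h0 := ih (by omega)
      have h1 := hmul ⟨k, by omega⟩ ⟨k + 1, hk⟩ (hchain _ _ rfl)
      have h2 := hsq ⟨k, by omega⟩
      rw [← h0]
      have h3 : c ⟨k, by omega⟩ ≠ 0 := fun h => by rw [h] at h2; norm_num at h2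
      exact mul_left_cancel₀ h3 (h1.trans h2.symm)
  rcases Nat.eq_zero_or_pos n with rfl | hn
  · exact Or.inl fun v => Subsingleton.elim _ _
  have hg' : (g : (Fin n → ℝ) →ₗ[ℝ] (Fin n → ℝ)) = c ⟨0, hn⟩ • LinearMap.id := by
    refine (Pi.basisFun ℝ (Fin n)).ext fun i => ?_
    rw [Pi.basisFun_apply]
    exact (hc i).trans (by rw [← hconst i i.2]; rfl)
  have hgv : ∀ v, g v = c ⟨0, hn⟩ • v := fun v => LinearMap.congr_fun hg' v
  rcases mul_self_eq_one_iff.1 (hsq ⟨0, hn⟩) with h | h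
  · exact Or.inl fun v => by rw [hgv, h, one_smul]
  · exact Or.inr fun v => by rw [hgv, h, neg_one_smul]

theorem center_eq_bot_of_neg_rev_mem (hsc : SignCoherent M) (hnd : CoxNondegenerate M)
    (hn : 2 ≤ n) (hrev : ∀ i j : Fin n, M i.rev j.rev = M i j)
    (hchain : ∀ i j : Fin n, (i : ℕ) + 1 = j → coxForm M (simpleRoot i) (simpleRoot j) ≠ 0)
    (h : ∃ g ∈ reflGroup M, ∀ v i, g v i = -v i.rev) :
    Subgroup.center (reflGroup M) = ⊥ := by
  obtain ⟨g₀, hg₀, hg₀v⟩ := h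
  rw [Subgroup.eq_bot_iff_forall]
  rintro ⟨g, hg⟩ hcenter
  rw [Subgroup.mem_center_iff] at hcenter
  have hcomm : ∀ i, g * simpleRefl M i = simpleRefl M i * g := fun i =>
    (congrArg Subtype.val (hcenter ⟨simpleRefl M i, simpleRefl_mem M i⟩)).symm
  rcases exists_smul_of_mem_center hchain hg hcomm with hgv | hgv
  · ext1
    ext1 v
    exact hgv v
  · exfalso
    -- If `-1` were in `W`, the reversal would be too. It preserves the closed chamber, hence would
    -- fix it pointwise, yet it moves the vector dual to the first simple root because `n ≥ 2`.
    obtain ⟨v, hv⟩ := exists_coxForm_eq hnd (Pi.single (⟨0, by omega⟩ : Fin n) 1)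
    have hdom : Dominant M v := fun i => by
      rw [hv]
      exact (Pi.single_nonneg.2 zero_le_one : (0 : Fin n → ℝ) ≤ Pi.single _ 1) i
    have hmap : (g * g₀) v = fun j => v j.rev := by
      rw [LinearEquiv.mul_apply, hgv]
      ext i
      simp [hg₀v]
    have heq := eq_of_dominant hsc (mul_mem hg hg₀) hdom (by
      rw [hmap]
      intro i
      rw [coxForm_simpleRoot_rev hrev]
      exact hdom _)
    have h1 := hv ⟨0, by omega⟩
    rw [← heq, hmap, coxForm_simpleRoot_rev hrev, hv, Pi.single_eq_same, Pi.single_eq_of_ne] at h1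
    · exact zero_ne_one h1
    · rw [Ne, Fin.ext_iff, Fin.val_rev]
      simp only
      omega

end Criterion

/-! ### Partial-sum coordinates for types A and B. -/

section Padding

variable {n : ℕ}

/-- The sequence `0, v 0, v 1, …, v (n - 1), 0, 0, …`. -/
def pad (v : Fin n → ℝ) (k : ℕ) : ℝ := ∑ j : Fin n, if (j : ℕ) + 1 = k then v j else 0

theorem pad_succ (v : Fin n → ℝ) (i : Fin n) : pad v (i + 1) = v i := by
  rw [pad, Finset.sum_eq_single i]
  · simp
  · intro j _ hj
    rw [if_neg]
    intro h
    exact hj (Fin.ext (by omega))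
  · simp

theorem pad_of_forall_ne (v : Fin n → ℝ) {k : ℕ} (h : ∀ j : Fin n, (j : ℕ) + 1 ≠ k) :
    pad v k = 0 :=
  Finset.sum_eq_zero fun j _ => if_neg (h j)

theorem pad_zero (v : Fin n → ℝ) : pad v 0 = 0 := pad_of_forall_ne v fun j => by omega

theorem pad_of_lt (v : Fin n → ℝ) {k : ℕ} (hk : n < k) : pad v k = 0 :=
  pad_of_forall_ne v fun j => by omega

theorem pad_simpleRoot (i : Fin n) (k : ℕ) :
    pad (simpleRoot i) k = if k = i + 1 then 1 else 0 := by
  by_cases h : ∃ j : Fin n, (j : ℕ) + 1 = k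
  · obtain ⟨j, rfl⟩ := h
    rw [pad_succ]
    by_cases hj : j = i
    · subst hj
      rw [simpleRoot_apply_self, if_pos rfl]
    · rw [simpleRoot_apply_of_ne hj, if_neg]
      intro h
      exact hj (Fin.ext (by omega))
  · push Not at h
    rw [pad_of_forall_ne _ h, if_neg fun hk => h i hk.symm]

theorem pad_sub_smul (v w : Fin n → ℝ) (c : ℝ) (k : ℕ) :
    pad (v - c • w) k = pad v k - c * pad w k := by
  rw [pad, pad, pad, Finset.mul_sum, ← Finset.sum_sub_distrib]
  refine Finset.sum_congr rfl fun j _ => ?_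
  split_ifs <;> simp

theorem pad_simpleRefl (M : CoxeterMatrix (Fin n)) (i : Fin n) (v : Fin n → ℝ) (k : ℕ) :
    pad (simpleRefl M i v) k =
      if k = i + 1 then v i - 2 * coxForm M (simpleRoot i) v else pad v k := by
  rw [simpleRefl_apply, pad_sub_smul, pad_simpleRoot]
  split_ifs with h
  · rw [h, pad_succ, mul_one]
  · rw [mul_zero, sub_zero]

/-- Rows of the Gram matrices of types A and B have at most three non-zero entries; zero padding
handles both ends of the graph uniformly. -/
theorem sum_three_eq_pad (v : Fin n → ℝ) (f : Fin n → ℝ) (a b c : ℝ) (i : ℕ)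
    (hf : ∀ j : Fin n, f j = (if (j : ℕ) + 1 = i then a else 0) +
      (if (j : ℕ) + 1 = i + 1 then b else 0) + if (j : ℕ) + 1 = i + 2 then c else 0) :
    ∑ j, f j * v j = a * pad v i + b * pad v (i + 1) + c * pad v (i + 2) := by
  rw [pad, pad, pad, Finset.mul_sum, Finset.mul_sum, Finset.mul_sum, ← Finset.sum_add_distrib,
    ← Finset.sum_add_distrib]
  refine Finset.sum_congr rfl fun j _ => ?_
  rw [hf]
  split_ifs <;> ring

/-- The indicator function of `{k | a < k}`. -/
def step (a k : ℕ) : ℝ := if a < k then 1 else 0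

theorem step_swap_of_ne (i a : ℕ) {k : ℕ} (hk : k ≠ i + 1) :
    step (Equiv.swap i (i + 1) a) k = step a k := by
  unfold step
  rw [Equiv.swap_apply_def]
  split_ifs <;> first | rfl | omega

theorem step_swap_self (i a : ℕ) :
    step (Equiv.swap i (i + 1) a) (i + 1) = step a i + step a (i + 2) - step a (i + 1) := by
  unfold step
  rw [Equiv.swap_apply_def]
  split_ifs <;> first | omega | norm_num

theorem step_nonneg (a k : ℕ) : 0 ≤ step a k := by
  unfold step
  split_ifs <;> norm_num

theorem step_anti {a b : ℕ} (h : a ≤ b) (k : ℕ) : step b k ≤ step a k := by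
  unfold step
  split_ifs <;> first | omega | norm_num

/-- Replacing the `(i + 1)`-st term of a sequence by its reflection in the mean of its two
neighbours interchanges two consecutive differences. -/
theorem sub_eq_sub_swap {V V' : ℕ → ℝ} {i : ℕ} (hne : ∀ k, k ≠ i + 1 → V' k = V k)
    (hself : V' (i + 1) = V i + V (i + 2) - V (i + 1)) (k : ℕ) :
    V' (k + 1) - V' k =
      V (Equiv.swap i (i + 1) k + 1) - V (Equiv.swap i (i + 1) k) := by
  rcases eq_or_ne k i with rfl | hk
  · rw [Equiv.swap_apply_left, hself, hne k (by omega)]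
    ring
  rcases eq_or_ne k (i + 1) with rfl | hk'
  · rw [Equiv.swap_apply_right, hself, hne (i + 1 + 1) (by omega)]
    ring
  · rw [Equiv.swap_apply_of_ne_of_ne hk hk', hne k hk', hne (k + 1) (by omega)]

end Padding

/-! ### Type A: permutations of the differences of `pad v`. -/

section TypeA

variable {n : ℕ}

theorem coxForm_A (i : Fin n) (v : Fin n → ℝ) :
    coxForm (CoxeterMatrix.A n) (simpleRoot i) v =
      pad v (i + 1) - (pad v i + pad v (i + 2)) / 2 := by
  rw [coxForm_simpleRoot_left, sum_three_eq_pad v _ (-(1 / 2)) 1 (-(1 / 2)) i]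
  · ring
  · intro j
    simp only [CoxeterMatrix.A, Matrix.of_apply, Fin.ext_iff]
    split_ifs <;> first | omega | norm_num

theorem pad_simpleRefl_A_of_ne (i : Fin n) (v : Fin n → ℝ) {k : ℕ} (hk : k ≠ i + 1) :
    pad (simpleRefl (CoxeterMatrix.A n) i v) k = pad v k := by
  rw [pad_simpleRefl, if_neg hk]

theorem pad_simpleRefl_A_self (i : Fin n) (v : Fin n → ℝ) :
    pad (simpleRefl (CoxeterMatrix.A n) i v) (i + 1) =
      pad v i + pad v (i + 2) - pad v (i + 1) := by
  rw [pad_simpleRefl, if_pos rfl, coxForm_A, pad_succ v i]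
  ring

/-- The roots are `e_a - e_b`. Their partial sums `step a - step b` are, up to sign, indicators of
intervals, and a simple reflection transposes adjacent indices. -/
theorem signCoherent_A (n : ℕ) : SignCoherent (CoxeterMatrix.A n) := by
  refine signCoherent_of_invariant {v | ∃ a b, ∀ k, pad v k = step a k - step b k} ?_ ?_ ?_
  · intro i
    refine ⟨i, i + 1, fun k => ?_⟩
    rw [pad_simpleRoot]
    unfold step
    split_ifs <;> first | omega | norm_num
  · rintro i v ⟨a, b, h⟩
    refine ⟨Equiv.swap (i : ℕ) (i + 1) a, Equiv.swap (i : ℕ) (i + 1) b, fun k => ?_⟩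
    by_cases hk : k = (i : ℕ) + 1
    · subst hk
      rw [pad_simpleRefl_A_self, step_swap_self, step_swap_self, h, h, h]
      ring
    · rw [pad_simpleRefl_A_of_ne i v hk, step_swap_of_ne _ _ hk, step_swap_of_ne _ _ hk, h]
  · rintro v ⟨a, b, h⟩
    rcases le_total a b with hab | hab
    · left
      intro j
      rw [Pi.zero_apply, ← pad_succ v j, h]
      exact sub_nonneg.2 (step_anti hab _)
    · right
      intro j
      rw [Pi.zero_apply, ← pad_succ v j, h]
      exact sub_nonpos.2 (step_anti hab _)

/-- Orthogonality to the simple roots says that the second differences of `pad v` vanish; a linear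
sequence that is zero at `0` and `n + 1` is zero. -/
theorem coxNondegenerate_A (n : ℕ) : CoxNondegenerate (CoxeterMatrix.A n) := by
  intro v hv
  have hrec : ∀ k ≤ n, pad v k = k * pad v 1 ∧ pad v (k + 1) = (k + 1) * pad v 1 := by
    intro k
    induction k with
    | zero => intro _; simp [pad_zero]
    | succ k ih =>
      intro hk
      obtain ⟨h1, h2⟩ := ih (by omega)
      have h3 := hv ⟨k, hk⟩
      rw [coxForm_A] at h3
      simp only at h3
      push_cast
      exact ⟨h2, by linear_combination (-2) * h3 + 2 * h2 - h1⟩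
  have h1 : pad v 1 = 0 := by
    have h2 := (hrec n le_rfl).2
    rw [pad_of_lt v (by omega)] at h2
    rcases mul_eq_zero.1 h2.symm with h3 | h3
    · have : (0 : ℝ) < n + 1 := by positivity
      linarith
    · exact h3
  ext i
  rw [← pad_succ v i, (hrec i i.2.le).2, h1, mul_zero, Pi.zero_apply]

theorem exists_perm_A (σ : Equiv.Perm (Fin (n + 1))) :
    ∃ g ∈ reflGroup (CoxeterMatrix.A n), ∀ v, ∀ k : Fin (n + 1),
      pad (g v) (σ k + 1) - pad (g v) (σ k) = pad v (k + 1) - pad v k := by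
  have hσ : σ ∈ Submonoid.closure (Set.range fun i : Fin n ↦ Equiv.swap i.castSucc i.succ) := by
    rw [Equiv.Perm.mclosure_swap_castSucc_succ]
    trivial
  induction hσ using Submonoid.closure_induction with
  | mem σ hσ =>
    obtain ⟨i, rfl⟩ := hσ
    refine ⟨_, simpleRefl_mem _ i, fun v k => ?_⟩
    have hval : ((Equiv.swap i.castSucc i.succ k : Fin (n + 1)) : ℕ) =
        Equiv.swap (i : ℕ) (i + 1) k := by
      rw [Equiv.swap_apply_def, Equiv.swap_apply_def]
      simp only [Fin.ext_iff, Fin.val_castSucc, Fin.val_succ]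
      split_ifs <;> rfl
    rw [sub_eq_sub_swap (fun k hk => pad_simpleRefl_A_of_ne i v hk) (pad_simpleRefl_A_self i v),
      hval, Equiv.swap_apply_self]
  | one => exact ⟨1, one_mem _, fun v k => rfl⟩
  | mul σ τ _ _ hσ hτ =>
    obtain ⟨g, hg, hgv⟩ := hσ
    obtain ⟨h, hh, hhv⟩ := hτ
    refine ⟨g * h, mul_mem hg hh, fun v k => ?_⟩
    rw [Equiv.Perm.mul_apply, LinearEquiv.mul_apply, hgv, hhv]

theorem neg_rev_mem_A (n : ℕ) :
    ∃ g ∈ reflGroup (CoxeterMatrix.A n), ∀ v i, g v i = -v i.rev := by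
  obtain ⟨g, hg, h⟩ := exists_perm_A (n := n) Fin.revPerm
  refine ⟨g, hg, fun v i => ?_⟩
  -- The reversed differences are summed from the right end, where `pad` vanishes as well; this
  -- produces the minus sign.
  have hk : ∀ k ≤ n + 1, pad (g v) (n + 1 - k) = -pad v k := by
    intro k
    induction k with
    | zero => intro _; rw [pad_zero, Nat.sub_zero, pad_of_lt _ (by omega), neg_zero]
    | succ k ih =>
      intro hk
      have h1 := ih (by omega)
      have h2 := h v ⟨k, hk⟩
      rw [Fin.revPerm_apply, Fin.val_rev] at h2
      simp only at h2
      rw [show n + 1 - (k + 1) + 1 = n + 1 - k by omega] at h2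
      linarith
  have := hk (i.rev + 1) (by omega)
  rw [pad_succ, Fin.val_rev, show n + 1 - (n - (i + 1) + 1) = (i : ℕ) + 1 by omega,
    pad_succ] at this
  exact this

theorem A_rev (i j : Fin n) :
    CoxeterMatrix.A n i.rev j.rev = CoxeterMatrix.A n i j := by
  simp only [CoxeterMatrix.A, Matrix.of_apply, Fin.ext_iff, Fin.val_rev]
  split_ifs <;> omega

theorem coxForm_A_chain (i j : Fin n) (h : (i : ℕ) + 1 = j) :
    coxForm (CoxeterMatrix.A n) (simpleRoot i) (simpleRoot j) ≠ 0 := by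
  rw [coxForm_A, pad_simpleRoot, pad_simpleRoot, pad_simpleRoot, if_neg (by omega),
    if_neg (by omega), if_pos (by omega)]
  norm_num

end TypeA

/-! ### Type B: signed permutations of the differences of `scaledPad v`. -/

section TypeB

variable {n : ℕ}

theorem sqrt_two_mul_sqrt_two : √2 * √2 = (2 : ℝ) := Real.mul_self_sqrt (by norm_num)

theorem coxForm_B_of_lt (i : Fin n) (hi : (i : ℕ) + 1 < n) (v : Fin n → ℝ) :
    coxForm (CoxeterMatrix.B n) (simpleRoot i) v =
      pad v (i + 1) - (pad v i + (if (i : ℕ) + 2 = n then √2 else 1) * pad v (i + 2)) / 2 := by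
  rw [coxForm_simpleRoot_left, sum_three_eq_pad v _ (-(1 / 2)) 1
    (-((if (i : ℕ) + 2 = n then √2 else 1) / 2)) i]
  · ring
  · intro j
    simp only [CoxeterMatrix.B, Matrix.of_apply, Fin.ext_iff]
    split_ifs <;> first | omega | norm_num

theorem coxForm_B_last (i : Fin n) (hi : (i : ℕ) + 1 = n) (v : Fin n → ℝ) :
    coxForm (CoxeterMatrix.B n) (simpleRoot i) v = pad v (i + 1) - √2 / 2 * pad v i := by
  rw [coxForm_simpleRoot_left, sum_three_eq_pad v _ (-(√2 / 2)) 1 0 i]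
  · ring
  · intro j
    simp only [CoxeterMatrix.B, Matrix.of_apply, Fin.ext_iff]
    split_ifs <;> first | omega | norm_num

/-- The partial sums of the coordinates of `v` in an orthogonal basis in which the group of type
`B` acts by signed permutations: the sequence `pad v` with the `n`-th term multiplied by `√2`. -/
noncomputable def scaledPad (v : Fin n → ℝ) (k : ℕ) : ℝ := (if k = n then √2 else 1) * pad v k

theorem scaledPad_zero (v : Fin n → ℝ) : scaledPad v 0 = 0 := by
  rw [scaledPad, pad_zero, mul_zero]

theorem scaledPad_simpleRefl_B_of_ne (i : Fin n) (v : Fin n → ℝ) {k : ℕ} (hk : k ≠ i + 1) :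
    scaledPad (simpleRefl (CoxeterMatrix.B n) i v) k = scaledPad v k := by
  rw [scaledPad, scaledPad, pad_simpleRefl, if_neg hk]

theorem scaledPad_simpleRefl_B_of_lt (i : Fin n) (hi : (i : ℕ) + 1 < n) (v : Fin n → ℝ) :
    scaledPad (simpleRefl (CoxeterMatrix.B n) i v) (i + 1) =
      scaledPad v i + scaledPad v (i + 2) - scaledPad v (i + 1) := by
  rw [scaledPad, scaledPad, scaledPad, scaledPad, pad_simpleRefl, if_pos rfl, coxForm_B_of_lt i hi,
    pad_succ v i, if_neg hi.ne, if_neg (show (i : ℕ) ≠ n by omega)]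
  ring

theorem scaledPad_simpleRefl_B_last (i : Fin n) (hi : (i : ℕ) + 1 = n)
    (v : Fin n → ℝ) :
    scaledPad (simpleRefl (CoxeterMatrix.B n) i v) (i + 1) =
      2 * scaledPad v i - scaledPad v (i + 1) := by
  rw [scaledPad, scaledPad, scaledPad, pad_simpleRefl, if_pos rfl, coxForm_B_last i hi,
    pad_succ v i, if_pos hi, if_neg (show (i : ℕ) ≠ n by omega)]
  linear_combination pad v i * sqrt_two_mul_sqrt_two

theorem scaledPad_nonneg_iff (v : Fin n → ℝ) (i : Fin n) : 0 ≤ scaledPad v (i + 1) ↔ 0 ≤ v i := by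
  rw [scaledPad, pad_succ]
  exact mul_nonneg_iff_of_pos_left (by split_ifs <;> positivity)

theorem scaledPad_nonpos_iff (v : Fin n → ℝ) (i : Fin n) : scaledPad v (i + 1) ≤ 0 ↔ v i ≤ 0 := by
  rw [scaledPad, pad_succ]
  rw [← neg_nonneg, ← mul_neg, mul_nonneg_iff_of_pos_left (by split_ifs <;> positivity),
    neg_nonneg]

theorem step_combination_sign {c d : ℝ} (hcd : c = d ∨ c = -d) {a b : ℕ} (hab : a ≤ b) :
    (∀ k, 0 ≤ c * step a k + d * step b k) ∨ ∀ k, c * step a k + d * step b k ≤ 0 := by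
  have h1 := fun k => step_anti hab k
  have h2 := step_nonneg b
  rcases le_total 0 c with hc | hc
  · left
    intro k
    rcases hcd with rfl | rfl
    · nlinarith [mul_le_mul_of_nonneg_left (h1 k) hc, mul_nonneg hc (h2 k)]
    · nlinarith [mul_le_mul_of_nonneg_left (h1 k) hc]
  · right
    intro k
    rcases hcd with rfl | rfl
    · nlinarith [mul_le_mul_of_nonpos_left (h1 k) hc,
        mul_nonpos_of_nonpos_of_nonneg hc (h2 k)]
    · nlinarith [mul_le_mul_of_nonpos_left (h1 k) hc]

theorem two_mul_step_sub_step_succ (a i k : ℕ) (hk : k ≤ i + 1) :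
    (if k = i + 1 then 2 * step a i - step a (i + 1) else step a k) =
      (if a = i then -1 else 1) * step a k := by
  unfold step
  split_ifs <;> first | omega | norm_num

/-- Up to scaling, the roots are `±e_a ± e_b` and `±e_a`, the latter with `a = b` and `c = d`. The
formula is imposed only for `k ≤ n`, since `scaledPad` vanishes beyond `n` while `step` does not. -/
theorem signCoherent_B (n : ℕ) : SignCoherent (CoxeterMatrix.B n) := by
  refine signCoherent_of_invariant {v | ∃ (c d : ℝ) (a b : ℕ), (c = d ∨ c = -d) ∧
    ∀ k ≤ n, scaledPad v k = c * step a k + d * step b k} ?_ ?_ ?_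
  · intro i
    by_cases hi : (i : ℕ) + 1 = n
    · refine ⟨√2 / 2, √2 / 2, i, i, Or.inl rfl, fun k hk => ?_⟩
      rw [scaledPad, pad_simpleRoot]
      unfold step
      split_ifs <;> first | omega | ring
    · refine ⟨1, -1, i, i + 1, Or.inr (by norm_num), fun k hk => ?_⟩
      rw [scaledPad, pad_simpleRoot]
      unfold step
      split_ifs <;> first | omega | norm_num
  · rintro i v ⟨c, d, a, b, hcd, h⟩
    by_cases hi : (i : ℕ) + 1 = n
    · refine ⟨c * (if a = i then -1 else 1), d * (if b = i then -1 else 1), a, b, ?_, ?_⟩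
      · rcases hcd with rfl | rfl <;> split_ifs <;> simp
      · intro k hk
        rw [mul_assoc, mul_assoc, ← two_mul_step_sub_step_succ a i k (by omega),
          ← two_mul_step_sub_step_succ b i k (by omega)]
        split_ifs with hki
        · rw [hki, scaledPad_simpleRefl_B_last i hi, h _ (by omega), h _ (by omega)]
          ring
        · rw [scaledPad_simpleRefl_B_of_ne i v hki, h k hk]
    · refine ⟨c, d, Equiv.swap (i : ℕ) (i + 1) a, Equiv.swap (i : ℕ) (i + 1) b, hcd,
        fun k hk => ?_⟩
      by_cases hki : k = (i : ℕ) + 1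
      · subst hki
        rw [scaledPad_simpleRefl_B_of_lt i (by omega), step_swap_self, step_swap_self,
          h _ (by omega), h _ (by omega), h _ (by omega)]
        ring
      · rw [scaledPad_simpleRefl_B_of_ne i v hki, step_swap_of_ne _ _ hki, step_swap_of_ne _ _ hki,
          h k hk]
  · rintro v ⟨c, d, a, b, hcd, h⟩
    have hsign : (∀ k, 0 ≤ c * step a k + d * step b k) ∨
        ∀ k, c * step a k + d * step b k ≤ 0 := by
      rcases le_total a b with hab | hab
      · exact step_combination_sign hcd hab
      · have hdc : d = c ∨ d = -c := hcd.imp Eq.symm fun h => by rw [h, neg_neg]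
        simpa only [add_comm] using step_combination_sign hdc hab
    refine hsign.imp (fun hs i => ?_) fun hs i => ?_
    · rw [Pi.zero_apply, ← scaledPad_nonneg_iff, h _ i.2]
      exact hs _
    · rw [Pi.zero_apply, ← scaledPad_nonpos_iff, h _ i.2]
      exact hs _

/-- The last simple reflection negates the last difference; conjugating by adjacent transpositions
moves this sign change down to position `j`. The induction is on the distance `m` from the end. -/
theorem exists_sign_change_B (m j : ℕ) (hj : j + m + 1 = n) :
    ∃ g ∈ reflGroup (CoxeterMatrix.B n), ∀ v, ∀ k < n,
      scaledPad (g v) (k + 1) - scaledPad (g v) k =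
        (if k = j then -1 else 1) * (scaledPad v (k + 1) - scaledPad v k) := by
  induction m generalizing j with
  | zero =>
    have hj' : j < n := by omega
    refine ⟨_, simpleRefl_mem _ ⟨j, hj'⟩, fun v k hk => ?_⟩
    rw [scaledPad_simpleRefl_B_of_ne (k := k) _ _ (by simp only; omega)]
    split_ifs with hkj
    · subst hkj
      rw [scaledPad_simpleRefl_B_last ⟨k, hj'⟩ hj]
      ring
    · rw [scaledPad_simpleRefl_B_of_ne _ _ (show k + 1 ≠ j + 1 from fun h => hkj (Nat.succ_injective h))]
      ring
  | succ m ih =>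
    obtain ⟨g, hg, hgv⟩ := ih (j + 1) (by omega)
    have hj' : j < n := by omega
    have hs := simpleRefl_mem (CoxeterMatrix.B n) ⟨j, hj'⟩
    have hswap := fun v => sub_eq_sub_swap
      (fun k hk => scaledPad_simpleRefl_B_of_ne (k := k) ⟨j, hj'⟩ v hk)
      (scaledPad_simpleRefl_B_of_lt ⟨j, hj'⟩ (by simp only; omega) v)
    simp only at hswap
    refine ⟨simpleRefl _ ⟨j, hj'⟩ * g * simpleRefl _ ⟨j, hj'⟩, mul_mem (mul_mem hs hg) hs,
      fun v k hk => ?_⟩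
    have hk' : Equiv.swap j (j + 1) k < n := by
      rw [Equiv.swap_apply_def]
      split_ifs <;> omega
    rw [LinearEquiv.mul_apply, LinearEquiv.mul_apply, hswap, hgv _ _ hk', hswap,
      Equiv.swap_apply_self]
    congr 1
    rw [Equiv.swap_apply_def]
    split_ifs <;> first | omega | rfl

theorem exists_sign_changes_B (m : ℕ) (hm : m ≤ n) :
    ∃ g ∈ reflGroup (CoxeterMatrix.B n), ∀ v, ∀ k < n,
      scaledPad (g v) (k + 1) - scaledPad (g v) k =
        (if k < m then -1 else 1) * (scaledPad v (k + 1) - scaledPad v k) := by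
  induction m with
  | zero => exact ⟨1, one_mem _, fun v k _ => by simp⟩
  | succ m ih =>
    obtain ⟨g, hg, hgv⟩ := ih (by omega)
    obtain ⟨h, hh, hhv⟩ := exists_sign_change_B (n := n) (n - 1 - m) m (by omega)
    refine ⟨g * h, mul_mem hg hh, fun v k hk => ?_⟩
    rw [LinearEquiv.mul_apply, hgv _ _ hk, hhv _ _ hk, ← mul_assoc]
    congr 1
    split_ifs <;> first | omega | norm_num

theorem neg_mem_B (n : ℕ) : ∃ g ∈ reflGroup (CoxeterMatrix.B n), ∀ v, g v = -v := by
  obtain ⟨g, hg, hgv⟩ := exists_sign_changes_B n le_rfl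
  refine ⟨g, hg, fun v => ?_⟩
  have h : ∀ k ≤ n, scaledPad (g v) k = -scaledPad v k := by
    intro k
    induction k with
    | zero => intro _; rw [scaledPad_zero, scaledPad_zero, neg_zero]
    | succ k ih =>
      intro hk
      have h1 := hgv v k hk
      rw [if_pos (show k < n from hk), ih (by omega)] at h1
      linarith
  ext i
  have h1 := h (i + 1) i.2
  rw [scaledPad, scaledPad, pad_succ, pad_succ, ← mul_neg] at h1
  exact mul_left_cancel₀ (by split_ifs <;> positivity) h1

end TypeB

/-- A group of type `M` which contains `-1` fixes no vector but zero. -/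
theorem coxNondegenerate_of_neg_mem {n : ℕ} {M : CoxeterMatrix (Fin n)}
    (h : ∃ g ∈ reflGroup M, ∀ v, g v = -v) : CoxNondegenerate M := by
  intro v hv
  obtain ⟨g, hg, hgv⟩ := h
  have hfix : g v = v := by
    clear hgv
    induction hg using Subgroup.closure_induction with
    | mem x hx =>
      obtain ⟨i, rfl⟩ := hx
      rw [simpleRefl_apply, hv, mul_zero, zero_smul, sub_zero]
    | one => rfl
    | mul x y _ _ hx hy => rw [LinearEquiv.mul_apply, hy, hx]
    | inv x _ hx =>
      nth_rw 1 [← hx]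
      rw [← LinearEquiv.mul_apply, inv_mul_cancel]
      rfl
  rw [hgv] at hfix
  exact self_eq_neg.1 hfix.symm

/-! ### Dihedral groups: roots indexed by integers. -/

section TypeI

theorem I_apply {d : ℕ} (hd : 2 ≤ d) (i j : Fin 2) :
    CoxeterMatrix.I (d - 2) i j = if i = j then 1 else d := by
  simp only [CoxeterMatrix.I, Matrix.of_apply]
  rw [Nat.sub_add_cancel hd]

variable {d : ℕ}

theorem simpleRefl_I_zero (hd : 2 ≤ d) (v : Fin 2 → ℝ) :
    simpleRefl (CoxeterMatrix.I (d - 2)) 0 v =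
      ![-v 0 + 2 * Real.cos (Real.pi / d) * v 1, v 1] := by
  rw [simpleRefl_apply, coxForm_simpleRoot_left, Fin.sum_univ_two, I_apply hd, I_apply hd]
  ext i
  fin_cases i
  · simp [simpleRoot]
    ring
  · simp [simpleRoot]

theorem simpleRefl_I_one (hd : 2 ≤ d) (v : Fin 2 → ℝ) :
    simpleRefl (CoxeterMatrix.I (d - 2)) 1 v =
      ![v 0, -v 1 + 2 * Real.cos (Real.pi / d) * v 0] := by
  rw [simpleRefl_apply, coxForm_simpleRoot_left, Fin.sum_univ_two, I_apply hd, I_apply hd]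
  ext i
  fin_cases i
  · simp [simpleRoot]
  · simp [simpleRoot]
    ring

/-- The (non-normalized) roots of the dihedral group of order `2 * d`. -/
noncomputable def dihRoot (d : ℕ) (k : ℤ) : Fin 2 → ℝ :=
  ![Real.sin ((k + 1) * (Real.pi / d)), Real.sin (k * (Real.pi / d))]

theorem dihRoot_add (hd : d ≠ 0) (k : ℤ) : dihRoot d (k + d) = -dihRoot d k := by
  have hd' : (d : ℝ) ≠ 0 := Nat.cast_ne_zero.2 hd
  ext i
  fin_cases i
  · simp only [dihRoot, Int.cast_add, Int.cast_natCast, Fin.zero_eta, Matrix.cons_val_zero,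
      Pi.neg_apply]
    rw [← Real.sin_add_pi]
    congr 1
    field_simp
    ring
  · simp only [dihRoot, Int.cast_add, Int.cast_natCast, Fin.mk_one, Matrix.cons_val_one,
      Matrix.cons_val_fin_one, Pi.neg_apply]
    rw [← Real.sin_add_pi]
    congr 1
    field_simp

theorem simpleRefl_I_zero_dihRoot (hd : 2 ≤ d) (k : ℤ) :
    simpleRefl (CoxeterMatrix.I (d - 2)) 0 (dihRoot d k) = -dihRoot d (-k) := by
  rw [simpleRefl_I_zero hd]
  ext i
  fin_cases i
  · simp only [dihRoot, Fin.zero_eta, Matrix.cons_val_zero, Matrix.cons_val_one,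
      Matrix.cons_val_fin_one, Pi.neg_apply, Int.cast_neg]
    rw [show (-(k : ℝ) + 1) * (Real.pi / d) = -(k * (Real.pi / d) - Real.pi / d) by ring,
      show ((k : ℝ) + 1) * (Real.pi / d) = k * (Real.pi / d) + Real.pi / d by ring,
      Real.sin_neg, Real.sin_sub, Real.sin_add]
    ring
  · simp [dihRoot]

theorem simpleRefl_I_one_dihRoot (hd : 2 ≤ d) (k : ℤ) :
    simpleRefl (CoxeterMatrix.I (d - 2)) 1 (dihRoot d k) = -dihRoot d (-k - 2) := by
  rw [simpleRefl_I_one hd]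
  ext i
  fin_cases i
  · simp [dihRoot]
    rw [← Real.sin_neg]
    ring_nf
  · simp only [dihRoot, Fin.mk_one, Matrix.cons_val_zero, Matrix.cons_val_one,
      Matrix.cons_val_fin_one, Pi.neg_apply, Int.cast_neg, Int.cast_sub, Int.cast_ofNat]
    rw [show (-(k : ℝ) - 2) * (Real.pi / d) = -((k + 1) * (Real.pi / d) + Real.pi / d) by ring,
      show (k : ℝ) * (Real.pi / d) = (k + 1) * (Real.pi / d) - Real.pi / d by ring,
      Real.sin_neg, Real.sin_sub, Real.sin_add]
    ring

theorem sin_pi_div_pos (hd : 2 ≤ d) : 0 < Real.sin (Real.pi / d) := by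
  have hd' : (1 : ℝ) < d := by exact_mod_cast hd
  exact Real.sin_pos_of_pos_of_lt_pi (by positivity) (div_lt_self Real.pi_pos hd')

theorem dihRoot_zero : dihRoot d 0 = Real.sin (Real.pi / d) • simpleRoot 0 := by
  ext i
  fin_cases i <;> simp [dihRoot, simpleRoot]

theorem dihRoot_neg_one : dihRoot d (-1) = -(Real.sin (Real.pi / d) • simpleRoot 1) := by
  ext i
  fin_cases i <;> simp [dihRoot, simpleRoot]

/-- Antiperiodicity reduces `k` modulo `d` up to sign; for `0 ≤ r < d` both sines are taken at
angles in `[0, π]`. -/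
theorem dihRoot_sign (hd : 2 ≤ d) (k : ℤ) : 0 ≤ dihRoot d k ∨ dihRoot d k ≤ 0 := by
  have hd0 : (0 : ℝ) < d := by positivity
  have hpos : ∀ r : ℕ, r ≤ d → 0 ≤ Real.sin (r * (Real.pi / d)) := by
    intro r hr
    have hr' : (r : ℝ) ≤ d := by exact_mod_cast hr
    apply Real.sin_nonneg_of_nonneg_of_le_pi (by positivity)
    rw [mul_div_assoc', div_le_iff₀ hd0, mul_comm]
    exact mul_le_mul_of_nonneg_left hr' Real.pi_pos.le
  have hroot : ∀ r : ℕ, r < d → 0 ≤ dihRoot d r := by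
    intro r hr i
    fin_cases i
    · simpa [dihRoot] using hpos (r + 1) hr
    · simpa [dihRoot] using hpos r hr.le
  have hneg : ∀ (q : ℕ) (r : ℤ), dihRoot d (r + q * d) = (-1 : ℝ) ^ q • dihRoot d r := by
    intro q r
    induction q with
    | zero => simp
    | succ q ih =>
      rw [Nat.cast_succ, add_mul, one_mul, ← add_assoc, dihRoot_add (by omega), ih, pow_succ,
        mul_neg_one, neg_smul]
  obtain ⟨r, hr⟩ := Int.eq_ofNat_of_zero_le (Int.emod_nonneg k (show (d : ℤ) ≠ 0 by omega))
  have hrd : r < d := by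
    have := Int.emod_lt_of_pos k (show (0 : ℤ) < d by omega)
    omega
  have hk : k = r + (k / d) * d := by
    rw [← hr, mul_comm]
    exact (Int.emod_add_mul_ediv k d).symm
  have hsign : dihRoot d k = dihRoot d r ∨ dihRoot d k = -dihRoot d r := by
    obtain ⟨q, hq | hq⟩ := Int.eq_nat_or_neg (k / d)
    · rw [hk, hq, hneg]
      rcases neg_one_pow_eq_or ℝ q with h | h <;> simp [h]
    · have := hneg q k
      have hk' : k + q * d = r := by rw [hq] at hk; linarith
      rw [hk'] at this
      rcases neg_one_pow_eq_or ℝ q with h | h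
      · left; rw [this, h, one_smul]
      · right; rw [this, h, neg_one_smul, neg_neg]
  rcases hsign with h | h
  · left; rw [h]; exact hroot r hrd
  · right; rw [h]; exact neg_nonpos.2 (hroot r hrd)

theorem signCoherent_I (hd : 2 ≤ d) : SignCoherent (CoxeterMatrix.I (d - 2)) := by
  have hs := sin_pi_div_pos hd
  -- The scalar `c` absorbs both the length `sin (π / d)` of the non-normalized roots and the signs
  -- from the reflections.
  refine signCoherent_of_invariant {v | ∃ (c : ℝ) (k : ℤ), v = c • dihRoot d k} ?_ ?_ ?_
  · intro i
    fin_cases i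
    · refine ⟨(Real.sin (Real.pi / d))⁻¹, 0, ?_⟩
      rw [dihRoot_zero, smul_smul, inv_mul_cancel₀ hs.ne', one_smul]
      rfl
    · refine ⟨-(Real.sin (Real.pi / d))⁻¹, -1, ?_⟩
      rw [dihRoot_neg_one, neg_smul_neg, smul_smul, inv_mul_cancel₀ hs.ne', one_smul]
      rfl
  · rintro i _ ⟨c, k, rfl⟩
    fin_cases i
    · refine ⟨-c, -k, ?_⟩
      rw [Fin.zero_eta, map_smul, simpleRefl_I_zero_dihRoot hd, smul_neg, neg_smul]
    · refine ⟨-c, -k - 2, ?_⟩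
      rw [Fin.mk_one, map_smul, simpleRefl_I_one_dihRoot hd, smul_neg, neg_smul]
  · rintro _ ⟨c, k, rfl⟩
    rcases le_total 0 c with hc | hc <;> rcases dihRoot_sign hd k with hk | hk
    · exact Or.inl (smul_nonneg hc hk)
    · exact Or.inr (smul_nonpos_of_nonneg_of_nonpos hc hk)
    · exact Or.inr (smul_nonpos_of_nonpos_of_nonneg hc hk)
    · exact Or.inl (smul_nonneg_of_nonpos_of_nonpos hc hk)

theorem coxNondegenerate_I (hd : 2 ≤ d) : CoxNondegenerate (CoxeterMatrix.I (d - 2)) := by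
  intro v hv
  have hs := sin_pi_div_pos hd
  have hsc := Real.sin_sq_add_cos_sq (Real.pi / d)
  have h0 := hv 0
  have h1 := hv 1
  rw [coxForm_simpleRoot_left, Fin.sum_univ_two, I_apply hd, I_apply hd] at h0 h1
  simp at h0 h1
  have hs2 : Real.sin (Real.pi / d) ^ 2 ≠ 0 := by positivity
  ext i
  fin_cases i
  · refine (mul_eq_zero.1 ?_).resolve_left hs2
    rw [Fin.zero_eta]
    linear_combination h0 + Real.cos (Real.pi / d) * h1 + v 0 * hsc
  · refine (mul_eq_zero.1 ?_).resolve_left hs2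
    rw [Fin.mk_one]
    linear_combination h1 + Real.cos (Real.pi / d) * h0 + v 1 * hsc

theorem exists_rotation_I (hd : 2 ≤ d) (m : ℕ) :
    ∃ g ∈ reflGroup (CoxeterMatrix.I (d - 2)), ∀ k, g (dihRoot d k) = dihRoot d (k + 2 * m) := by
  induction m with
  | zero => exact ⟨1, one_mem _, fun k => by simp⟩
  | succ m ih =>
    obtain ⟨g, hg, h⟩ := ih
    refine ⟨g * (simpleRefl _ 0 * simpleRefl _ 1),
      mul_mem hg (mul_mem (simpleRefl_mem _ 0) (simpleRefl_mem _ 1)), fun k => ?_⟩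
    rw [LinearEquiv.mul_apply, LinearEquiv.mul_apply, simpleRefl_I_one_dihRoot hd, map_neg,
      simpleRefl_I_zero_dihRoot hd, neg_neg, h]
    congr 1
    push_cast
    ring

theorem eq_of_dihRoot (hd : 2 ≤ d) {f g : (Fin 2 → ℝ) →ₗ[ℝ] (Fin 2 → ℝ)}
    (h0 : f (dihRoot d 0) = g (dihRoot d 0)) (h1 : f (dihRoot d (-1)) = g (dihRoot d (-1))) :
    f = g := by
  have hs := sin_pi_div_pos hd
  refine (Pi.basisFun ℝ (Fin 2)).ext fun i => ?_
  rw [Pi.basisFun_apply]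
  fin_cases i
  · rw [dihRoot_zero, map_smul, map_smul] at h0
    exact smul_right_injective _ hs.ne' h0
  · rw [dihRoot_neg_one, map_neg, map_neg, neg_inj, map_smul, map_smul] at h1
    exact smul_right_injective _ hs.ne' h1

theorem neg_mem_I (hd : 2 ≤ d) (heven : Even d) :
    ∃ g ∈ reflGroup (CoxeterMatrix.I (d - 2)), ∀ v, g v = -v := by
  obtain ⟨m, hm⟩ := heven
  obtain ⟨g, hg, h⟩ := exists_rotation_I hd m
  refine ⟨g, hg, ?_⟩
  have hneg : ∀ k, g (dihRoot d k) = -dihRoot d k := fun k => by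
    rw [h, ← dihRoot_add (by omega)]
    congr 1
    omega
  exact LinearMap.congr_fun (eq_of_dihRoot (f := g.toLinearMap) (g := -LinearMap.id) hd
    (hneg 0) (hneg (-1)))

theorem neg_rev_mem_I (hd : 2 ≤ d) (hodd : Odd d) :
    ∃ g ∈ reflGroup (CoxeterMatrix.I (d - 2)), ∀ v i, g v i = -v i.rev := by
  obtain ⟨m, hm⟩ := hodd
  obtain ⟨g, hg, h⟩ := exists_rotation_I hd m
  refine ⟨g * simpleRefl _ 0, mul_mem hg (simpleRefl_mem _ 0), ?_⟩
  -- With `d = 2m + 1`, the reflection `s_0` followed by the shift by `2m = d - 1` gives `k ↦ -1 -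
  -- k` on indices, which exchanges the two sines and negates them.
  have hrev : ∀ k, (g * simpleRefl (CoxeterMatrix.I (d - 2)) 0) (dihRoot d k) = dihRoot d (-1 - k) := fun k => by
    rw [LinearEquiv.mul_apply, simpleRefl_I_zero_dihRoot hd, map_neg, h, ← dihRoot_add (by omega),
      ← neg_neg (dihRoot d (-1 - k)), ← dihRoot_add (by omega), ← dihRoot_add (by omega)]
    congr 1
    omega
  have heq := eq_of_dihRoot (f := (g * simpleRefl (CoxeterMatrix.I (d - 2)) 0).toLinearMap)
    (g := -(LinearMap.funLeft ℝ ℝ Fin.rev)) hd ?_ ?_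
  · intro v i
    exact congrFun (LinearMap.congr_fun heq v) i
  · refine (hrev 0).trans ?_
    ext i
    fin_cases i <;> simp [dihRoot, LinearMap.funLeft_apply]
  · refine (hrev (-1)).trans ?_
    ext i
    fin_cases i <;> simp [dihRoot, LinearMap.funLeft_apply]

theorem I_rev (hd : 2 ≤ d) (i j : Fin 2) :
    CoxeterMatrix.I (d - 2) i.rev j.rev = CoxeterMatrix.I (d - 2) i j := by
  rw [I_apply hd, I_apply hd]
  simp only [Fin.rev_inj]

theorem coxForm_I_chain (hd : 3 ≤ d) (i j : Fin 2) (h : (i : ℕ) + 1 = j) :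
    coxForm (CoxeterMatrix.I (d - 2)) (simpleRoot i) (simpleRoot j) ≠ 0 := by
  rw [coxForm_simpleRoot_simpleRoot, I_apply (by omega), if_neg (by rintro rfl; omega), neg_ne_zero]
  have hd' : (2 : ℝ) < d := by exact_mod_cast hd
  refine (Real.cos_pos_of_mem_Ioo ⟨?_, ?_⟩).ne'
  · have : 0 < Real.pi / d := by positivity
    linarith [Real.pi_pos]
  · exact div_lt_div_of_pos_left Real.pi_pos two_pos hd'

end TypeI

/-! ### Type H₃: exact computation over `ℤ[φ]`. -/

section TypeH

/-- The element `x.1 + x.2 * φ` of `ℤ[φ]`, where `φ` is the golden ratio. -/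
noncomputable def goldenVal (x : ℤ × ℤ) : ℝ := x.1 + x.2 * Real.goldenRatio

/-- Multiplication by the golden ratio in `ℤ[φ]`. -/
def mulGolden (x : ℤ × ℤ) : ℤ × ℤ := (x.2, x.1 + x.2)

theorem goldenVal_mulGolden (x : ℤ × ℤ) :
    goldenVal (mulGolden x) = Real.goldenRatio * goldenVal x := by
  simp only [goldenVal, mulGolden, Int.cast_add]
  linear_combination (-(x.2 : ℝ)) * Real.goldenRatio_sq

theorem goldenVal_add (x y : ℤ × ℤ) : goldenVal (x + y) = goldenVal x + goldenVal y := by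
  simp only [goldenVal, Prod.fst_add, Prod.snd_add, Int.cast_add]
  ring

theorem goldenVal_neg (x : ℤ × ℤ) : goldenVal (-x) = -goldenVal x := by
  simp only [goldenVal, Prod.fst_neg, Prod.snd_neg, Int.cast_neg]
  ring

/-- The vector in `ℝ³` with the given coordinates in `ℤ[φ]`. -/
noncomputable def goldenVec (x : (ℤ × ℤ) × (ℤ × ℤ) × (ℤ × ℤ)) : Fin 3 → ℝ :=
  ![goldenVal x.1, goldenVal x.2.1, goldenVal x.2.2]

/-- The action of the simple reflections of type `H₃` on `ℤ[φ]³`. -/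
def goldenRefl (i : Fin 3) (x : (ℤ × ℤ) × (ℤ × ℤ) × (ℤ × ℤ)) : (ℤ × ℤ) × (ℤ × ℤ) × (ℤ × ℤ) :=
  ![(-x.1 + x.2.1, x.2.1, x.2.2),
    (x.1, -x.2.1 + x.1 + mulGolden x.2.2, x.2.2),
    (x.1, x.2.1, -x.2.2 + mulGolden x.2.1)] i

theorem goldenVec_neg (x : (ℤ × ℤ) × (ℤ × ℤ) × (ℤ × ℤ)) : goldenVec (-x) = -goldenVec x := by
  ext i
  fin_cases i <;> simp [goldenVec, goldenVal_neg]

/-- As `2 cos (π / 5) = φ`, the reflections preserve `ℤ[φ]³`, so statements about roots become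
decidable computations with integer pairs. -/
theorem simpleRefl_H₃_goldenVec (i : Fin 3) (x : (ℤ × ℤ) × (ℤ × ℤ) × (ℤ × ℤ)) :
    simpleRefl CoxeterMatrix.H₃ i (goldenVec x) = goldenVec (goldenRefl i x) := by
  have hcos : Real.cos (Real.pi / 5) = Real.goldenRatio / 2 := by
    rw [Real.cos_pi_div_five, Real.goldenRatio]
    ring
  rw [simpleRefl_apply, coxForm_simpleRoot_left, Fin.sum_univ_three]
  ext j
  fin_cases i <;> fin_cases j <;>
    simp [CoxeterMatrix.H₃, simpleRoot, goldenVec, goldenRefl, goldenVal_add, goldenVal_neg,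
      goldenVal_mulGolden, -Real.cos_pi_div_five, hcos] <;> ring

/-- The positive roots of type `H₃`. -/
def goldenRoots : List ((ℤ × ℤ) × (ℤ × ℤ) × (ℤ × ℤ)) :=
  [((1, 0), (0, 0), (0, 0)), ((0, 0), (1, 0), (0, 0)), ((0, 0), (0, 0), (1, 0)),
    ((1, 0), (1, 0), (0, 0)), ((0, 0), (1, 0), (0, 1)), ((0, 0), (0, 1), (1, 0)),
    ((0, 0), (0, 1), (0, 1)), ((1, 0), (1, 0), (0, 1)), ((0, 1), (0, 1), (1, 0)),
    ((0, 1), (0, 1), (0, 1)), ((1, 0), (1, 1), (0, 1)), ((1, 0), (1, 1), (1, 1)),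
    ((0, 1), (1, 1), (0, 1)), ((0, 1), (1, 1), (1, 1)), ((0, 1), (0, 2), (1, 1))]

/-- The simple roots of type `H₃`. -/
def goldenSimpleRoot (i : Fin 3) : (ℤ × ℤ) × (ℤ × ℤ) × (ℤ × ℤ) :=
  ![((1, 0), (0, 0), (0, 0)), ((0, 0), (1, 0), (0, 0)), ((0, 0), (0, 0), (1, 0))] i

theorem goldenVec_goldenSimpleRoot (i : Fin 3) :
    goldenVec (goldenSimpleRoot i) = simpleRoot i := by
  ext j
  fin_cases i <;> fin_cases j <;> simp [goldenVec, goldenSimpleRoot, simpleRoot, goldenVal]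

set_option maxRecDepth 4000 in
theorem goldenRefl_mem : ∀ x ∈ goldenRoots, ∀ i,
    goldenRefl i x ∈ goldenRoots ∨ -goldenRefl i x ∈ goldenRoots := by
  decide

theorem goldenRoots_nonneg : ∀ x ∈ goldenRoots,
    (0 ≤ x.1.1 ∧ 0 ≤ x.1.2) ∧ (0 ≤ x.2.1.1 ∧ 0 ≤ x.2.1.2) ∧ 0 ≤ x.2.2.1 ∧ 0 ≤ x.2.2.2 := by
  decide

theorem goldenVal_nonneg {x : ℤ × ℤ} (h : 0 ≤ x.1 ∧ 0 ≤ x.2) : 0 ≤ goldenVal x := by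
  have h1 : (0 : ℝ) ≤ x.1 := by exact_mod_cast h.1
  have h2 : (0 : ℝ) ≤ x.2 := by exact_mod_cast h.2
  have := Real.goldenRatio_pos
  unfold goldenVal
  positivity

theorem goldenVec_nonneg {x : (ℤ × ℤ) × (ℤ × ℤ) × (ℤ × ℤ)} (hx : x ∈ goldenRoots) :
    0 ≤ goldenVec x := by
  obtain ⟨h0, h1, h2⟩ := goldenRoots_nonneg x hx
  intro i
  fin_cases i
  · exact goldenVal_nonneg h0
  · exact goldenVal_nonneg h1
  · exact goldenVal_nonneg h2

theorem signCoherent_H₃ : SignCoherent CoxeterMatrix.H₃ := by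
  refine signCoherent_of_invariant
    {v | ∃ x ∈ goldenRoots, v = goldenVec x ∨ v = -goldenVec x} ?_ ?_ ?_
  · intro i
    refine ⟨goldenSimpleRoot i, ?_, Or.inl (goldenVec_goldenSimpleRoot i).symm⟩
    fin_cases i <;> decide
  · rintro i v ⟨x, hx, hv⟩
    have hv' : simpleRefl CoxeterMatrix.H₃ i v = goldenVec (goldenRefl i x) ∨
        simpleRefl CoxeterMatrix.H₃ i v = -goldenVec (goldenRefl i x) := by
      rcases hv with rfl | rfl
      · exact Or.inl (simpleRefl_H₃_goldenVec i x)
      · right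
        rw [map_neg, simpleRefl_H₃_goldenVec]
    rcases goldenRefl_mem x hx i with h | h
    · exact ⟨_, h, hv'⟩
    · refine ⟨_, h, ?_⟩
      rw [goldenVec_neg, neg_neg]
      exact hv'.symm
  · rintro v ⟨x, hx, rfl | rfl⟩
    · exact Or.inl (goldenVec_nonneg hx)
    · exact Or.inr (neg_nonpos.2 (goldenVec_nonneg hx))

theorem reflWord_H₃_goldenVec (L : List (Fin 3)) (x : (ℤ × ℤ) × (ℤ × ℤ) × (ℤ × ℤ)) :
    reflWord CoxeterMatrix.H₃ L (goldenVec x) = goldenVec (L.foldr goldenRefl x) := by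
  induction L with
  | nil => rfl
  | cons i L ih =>
    rw [reflWord_cons, LinearEquiv.mul_apply, ih, simpleRefl_H₃_goldenVec, List.foldr_cons]

/-- The word is the fifth power of the Coxeter element `s_0 s_1 s_2`, half its order 10, and acts as
`-1`. -/
theorem foldr_goldenRefl_goldenSimpleRoot : ∀ i,
    [0, 1, 2, 0, 1, 2, 0, 1, 2, 0, 1, 2, 0, 1, 2].foldr goldenRefl (goldenSimpleRoot i) =
      -goldenSimpleRoot i := by
  decide

theorem neg_mem_H₃ : ∃ g ∈ reflGroup CoxeterMatrix.H₃, ∀ v, g v = -v := by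
  obtain ⟨g, hg, h⟩ : ∃ g ∈ reflGroup CoxeterMatrix.H₃, ∀ i, g (simpleRoot i) = -simpleRoot i := by
    refine ⟨_, reflWord_mem _ [0, 1, 2, 0, 1, 2, 0, 1, 2, 0, 1, 2, 0, 1, 2], fun i => ?_⟩
    rw [← goldenVec_goldenSimpleRoot, reflWord_H₃_goldenVec, foldr_goldenRefl_goldenSimpleRoot,
      goldenVec_neg]
  refine ⟨g, hg, LinearMap.congr_fun (f := g.toLinearMap) (g := -LinearMap.id)
    ((Pi.basisFun ℝ (Fin 3)).ext fun i => ?_)⟩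
  rw [Pi.basisFun_apply]
  exact h i

end TypeH

/-! ### Collecting the types and concluding. -/

theorem IsConsidered.cases {n : ℕ} {M : CoxeterMatrix (Fin n)} (hM : IsConsidered M)
    (hn : 2 ≤ n) : SignCoherent M ∧ CoxNondegenerate M ∧
      ((∃ g ∈ reflGroup M, ∀ v, g v = -v) ∨
        ((∃ g ∈ reflGroup M, ∀ v i, g v i = -v i.rev) ∧
          (∀ i j : Fin n, M i.rev j.rev = M i j) ∧
          ∀ i j : Fin n, (i : ℕ) + 1 = j →
            coxForm M (simpleRoot i) (simpleRoot j) ≠ 0)) := by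
  cases hM with
  | alpha _ _ =>
    exact ⟨signCoherent_A n, coxNondegenerate_A n, Or.inr ⟨neg_rev_mem_A n, A_rev, coxForm_A_chain⟩⟩
  | beta _ _ =>
    exact ⟨signCoherent_B n, coxNondegenerate_of_neg_mem (neg_mem_B n), Or.inl (neg_mem_B n)⟩
  | dih d hd =>
    have hd2 : 2 ≤ d := by omega
    refine ⟨signCoherent_I hd2, coxNondegenerate_I hd2, ?_⟩
    rcases Nat.even_or_odd d with h | h
    · exact Or.inl (neg_mem_I hd2 h)
    · exact Or.inr ⟨neg_rev_mem_I hd2 h, I_rev hd2, coxForm_I_chain hd⟩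
  | icosahedral =>
    exact ⟨signCoherent_H₃, coxNondegenerate_of_neg_mem neg_mem_H₃, Or.inl neg_mem_H₃⟩

theorem mainTheorem4 {n : ℕ} (M : CoxeterMatrix (Fin n)) (hM : IsConsidered M)
    (I J : Finset (Fin n)) (hI : I.card + 1 = n) (hJ : J.card + 1 = n)
    (hI₀ : I.Nonempty) (hJ₀ : J.Nonempty)
    (p q : Fin n → ℝ) (hp : p ∈ facet M I) (hq : q ∈ facet M J) (hpq : I = J → p = q)
    (G : Subgroup ((Fin n → ℝ) ≃ₗ[ℝ] (Fin n → ℝ)))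
    (hG : G = reflGroup M ∨ (G = rotGroup M ∧ (3 ≤ n ∨ I = J))) :
    (((Subgroup.center (reflGroup M) ≠ ⊥ ∧ I = J) ∨
        (Subgroup.center (reflGroup M) = ⊥ ∧ I = dualSet J)) →
      numUnivalent M G p q = 1) ∧
    (¬ ((Subgroup.center (reflGroup M) ≠ ⊥ ∧ I = J) ∨
        (Subgroup.center (reflGroup M) = ⊥ ∧ I = dualSet J)) →
      numUnivalent M G p q = 0) := by
  have hn : 2 ≤ n := by
    have := Finset.card_pos.2 hI₀
    omega
  obtain ⟨hsc, hnd, h⟩ := hM.cases hn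
  -- Both alternatives of the theorem say that `Wq` meets the ray opposite to `p`.
  have key : ((Subgroup.center (reflGroup M) ≠ ⊥ ∧ I = J) ∨
      (Subgroup.center (reflGroup M) = ⊥ ∧ I = dualSet J)) ↔
      ∃ g ∈ reflGroup M, ∃ t : ℝ, t < 0 ∧ g q = t • p := by
    rcases h with h | ⟨h, hrev, hchain⟩
    · have hc := center_ne_bot_of_neg_mem (by omega) h
      rw [exists_neg_iff_of_neg_mem hsc hp hq hpq h]
      simp [hc]
    · have hc := center_eq_bot_of_neg_rev_mem hsc hnd hn hrev hchain h
      rw [exists_neg_iff_of_neg_rev_mem hsc hnd hrev hI hp hq h]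
      simp [hc]
  rw [key]
  exact ⟨numUnivalent_eq_one hsc hnd hI hJ hI₀ hJ₀ hp hq hpq hG,
    numUnivalent_eq_zero hsc hnd hI hJ hI₀ hJ₀ hp hq hpq hG⟩
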